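/- All graphs are finite and simple. $G+H$ is the disjoint union and $G\oplus H$ the join of $G$ and $H$, and $nG$ is the disjoint union of $n$ copies of $G$. A cograph is a graph with no induced path on four vertices. A cluster is the complement of a complete multipartite graph (a disjoint union of cliques). For $s,k\in\{0,1,2,\dots\}\cup\{\infty\}$, a graph is $(s,k)$-polar if its vertex set has a partition $(A,B)$ (parts may be empty) such that $A$ induces a complete multipartite graph with at most $s$ parts and $B$ induces a cluster with at most $k$ components; $\infty$ means no bound. A cograph minimal $(s,k)$-polar obstruction is a cograph that is not $(s,k)$-polar but all of whose proper induced subgraphs are $(s,k)$-polar. Theorem. Let $k\ge 2$ be an integer, and let $G$ be a graph with at least one connected component isomorphic to $P_3$. Then $G$ is a cograph minimal $(\infty,k)$-polar obstruction if and only if there is a graph $H$ such that $G\cong P_3+H$ and one of the following holds: 1. $H\cong P_3+(k-1)K_2$; 2. $H\cong (k-2)K_2+(K_1\oplus 2K_2)$; 3. for some integer $j\in\{1,\dots,k-1\}$, $H\cong (k-j-1)K_2+H_j$, where $H_j$ is a connected cograph minimal $(1,j)$-polar obstruction that is not a cograph minimal $(1,\infty)$-polar obstruction; 4. $k\ge 3$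 and $H$ is a cograph minimal $(1,\infty)$-polar obstruction. -/

import Mathlib

universe u

namespace Polarity

/-- A cograph is a graph without a four-vertex path as an induced subgraph. -/
def IsCograph {V : Type*} (G : SimpleGraph V) : Prop :=
  ¬ (SimpleGraph.pathGraph 4).IsIndContained G

/-- `G` is complete multipartite with at most `s` parts, where `s = ⊤` means that the number of
parts is unbounded. The parts are the classes of the relation of being nonadjacent. -/
def IsCompleteMultipartiteLE {V : Type*} (s : ℕ∞) (G : SimpleGraph V) : Prop :=
  ∃ h : G.IsCompleteMultipartite, ENat.card (Quotient h.setoid) ≤ s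

/-- A cluster is the complement of a complete multipartite graph. -/
def IsCluster {V : Type*} (G : SimpleGraph V) : Prop :=
  Gᶜ.IsCompleteMultipartite

/-- `G` is a cluster with at most `k` connected components, where `k = ⊤` means that the number of
components is unbounded. -/
def IsClusterLE {V : Type*} (k : ℕ∞) (G : SimpleGraph V) : Prop :=
  IsCluster G ∧ ENat.card G.ConnectedComponent ≤ k

/-- `G` admits an `(s, k)`-polar partition `(A, Aᶜ)`; either part may be empty. -/
def IsPolar {V : Type*} (s k : ℕ∞) (G : SimpleGraph V) : Prop :=
  ∃ A : Set V, IsCompleteMultipartiteLE s (G.induce A) ∧ IsClusterLE k (G.induce Aᶜ)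

/-- `G` is a cograph minimal `(s, k)`-polar obstruction: a cograph that is not `(s, k)`-polar, all
of whose proper induced subgraphs are `(s, k)`-polar. -/
def IsCographMinimalObstruction {V : Type*} (s k : ℕ∞) (G : SimpleGraph V) : Prop :=
  IsCograph G ∧ ¬ IsPolar s k G ∧ ∀ S : Set V, S ≠ Set.univ → IsPolar s k (G.induce S)

/-- The join of two graphs: their disjoint union together with all edges between them. -/
def join {V W : Type*} (G : SimpleGraph V) (H : SimpleGraph W) : SimpleGraph (V ⊕ W) :=
  (G ⊕g H) ⊔ completeBipartiteGraph V W

/-- The disjoint union of `n` copies of `G`. -/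
def copies {V : Type*} (n : ℕ) (G : SimpleGraph V) : SimpleGraph (Fin n × V) where
  Adj p q := p.1 = q.1 ∧ G.Adj p.2 q.2
  symm := ⟨fun _ _ h => ⟨h.1.symm, h.2.symm⟩⟩
  loopless := ⟨fun p h => G.loopless.irrefl p.2 h.2⟩

/-- The path on three vertices. -/
abbrev P3 : SimpleGraph (Fin 3) := SimpleGraph.pathGraph 3

/-- The complete graph on `n` vertices. -/
abbrev K (n : ℕ) : SimpleGraph (Fin n) := SimpleGraph.completeGraph (Fin n)

end Polarity

namespace Polarity

open Set

/-! A complete multipartite graph with an edge is connected, so in a polar partition of a disjoint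
union the part `A` is either independent or contained in one summand. Since `P3` is not a cluster, a
polar partition of `P3 + H` has one of two forms. Either `A` is independent, `P3` uses one clique
and `H` is `(1, k-1)`-polar, or `A` lies in `P3` and `H` is a cluster with at most `k` components.
With `k = m + 2`, minimality of `P3 + H` becomes the list of conditions `IsResidue m H`
(`isCographMinimalObstruction_P3_sum`).

Suppose first that `H` has no `(1, ∞)`-polar partition. Its vertex-deleted subgraphs are monopolar,
that is, `(1, ∞)`-polar, so `H` is one of four explicit graphs
(`IsCographMinimalObstruction.nonempty_iso`). Each of them is a residue exactly when `m ≥ 1`; this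
is condition 4.

Suppose now that `H` is monopolar. It is not a cluster, so some component `D` contains an induced
`P3`, and minimality forces every other component to be a single edge. If there are `a` edges, each
costs exactly one colour. Put `j = m + 1 - a`; then `D` is `(1, j+1)`-polar but not `(1, j)`-polar,
and each `D - v` is `(1, j)`-polar or a cluster. The value `j = 0` gives `D = P3`. For `j ≥ 1`,
either every `D - v` is `(1, j)`-polar, which is condition 3, or some `D - v` is only a cluster,
which forces `j = 1` and `D = K₁ ⊕ 2K₂`. The structural tool is that a connected monopolar cograph
that is not split is the join of an independent set and a cluster
(`IsCograph.exists_indep_join_cluster`).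

Everything is phrased on vertex subsets of a fixed graph, a cluster being given by a colouring, so
that colours can be counted without passing to subtypes. -/

/-- `B` induces a cluster of `G` with at most `n` components: its vertices can be coloured with
`n` colours so that distinct vertices are adjacent exactly when they have the same colour. -/
def ClusterOn {V : Type*} (G : SimpleGraph V) (B : Set V) (n : ℕ) : Prop :=
  ∃ f : V → ℕ, (∀ u ∈ B, f u < n) ∧ ∀ u ∈ B, ∀ v ∈ B, u ≠ v → (G.Adj u v ↔ f u = f v)

/-- `S` induces a `(1, n)`-polar subgraph of `G`. -/
def MonoOn {V : Type*} (G : SimpleGraph V) (S : Set V) (n : ℕ) : Prop :=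
  ∃ A ⊆ S, (∀ a ∈ A, ∀ b ∈ A, ¬ G.Adj a b) ∧ ClusterOn G (S \ A) n

/-- `S` induces an `(∞, n)`-polar subgraph of `G`. -/
def PolarOn {V : Type*} (G : SimpleGraph V) (S : Set V) (n : ℕ) : Prop :=
  ∃ A ⊆ S, (∀ a ∈ A, ∀ b ∈ A, ∀ c ∈ A, ¬ G.Adj a b → ¬ G.Adj b c → ¬ G.Adj a c) ∧
    ClusterOn G (S \ A) n

/-! ### Monotonicity and transport of the relative notions -/

section Basic

variable {V W : Type*} {G : SimpleGraph V} {H : SimpleGraph W} {S T : Set V} {m n : ℕ}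

lemma ClusterOn.mono (h : ClusterOn G T m) (hS : S ⊆ T) (hn : m ≤ n) : ClusterOn G S n := by
  obtain ⟨f, h1, h2⟩ := h
  exact ⟨f, fun u hu => (h1 u (hS hu)).trans_le hn, fun u hu v hv => h2 u (hS hu) v (hS hv)⟩

lemma MonoOn.mono (h : MonoOn G T m) (hS : S ⊆ T) (hn : m ≤ n) : MonoOn G S n := by
  obtain ⟨A, hA, h1, h2⟩ := h
  refine ⟨A ∩ S, inter_subset_right, fun a ha b hb => h1 a ha.1 b hb.1, h2.mono ?_ hn⟩
  rintro x ⟨hx, hxA⟩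
  exact ⟨hS hx, fun h => hxA ⟨h, hx⟩⟩

lemma PolarOn.mono (h : PolarOn G T m) (hS : S ⊆ T) (hn : m ≤ n) : PolarOn G S n := by
  obtain ⟨A, hA, h1, h2⟩ := h
  refine ⟨A ∩ S, inter_subset_right, fun a ha b hb c hc => h1 a ha.1 b hb.1 c hc.1,
    h2.mono ?_ hn⟩
  rintro x ⟨hx, hxA⟩
  exact ⟨hS hx, fun h => hxA ⟨h, hx⟩⟩

lemma ClusterOn.monoOn (h : ClusterOn G S n) : MonoOn G S n :=
  ⟨∅, empty_subset _, by simp, by simpa using h⟩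

lemma MonoOn.polarOn (h : MonoOn G S n) : PolarOn G S n := by
  obtain ⟨A, hA, h1, h2⟩ := h
  exact ⟨A, hA, fun a ha _ _ c hc _ _ => h1 a ha c hc, h2⟩

lemma clusterOn_empty : ClusterOn G ∅ n := ⟨fun _ => 0, by simp, by simp⟩

/-- Any type of colours may be used. -/
lemma ClusterOn.of_finset {α : Type*} (f : V → α) (F : Finset α) (hF : ∀ u ∈ S, f u ∈ F)
    (hn : F.card ≤ n) (h : ∀ u ∈ S, ∀ v ∈ S, u ≠ v → (G.Adj u v ↔ f u = f v)) :
    ClusterOn G S n := by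
  classical
  refine ⟨fun u => if h : f u ∈ F then F.equivFin ⟨f u, h⟩ else 0, fun u hu => ?_,
    fun u hu v hv huv => ?_⟩
  · simp only [hF u hu, dif_pos]
    exact (F.equivFin _).2.trans_le hn
  · simp only [hF u hu, hF v hv, dif_pos]
    rw [h u hu v hv huv, Fin.val_inj, F.equivFin.injective.eq_iff, Subtype.mk.injEq]

/-- No induced path on three vertices inside a cluster. -/
lemma ClusterOn.adj_trans (h : ClusterOn G S n) {a b c : V} (ha : a ∈ S) (hb : b ∈ S) (hc : c ∈ S)
    (hab : G.Adj a b) (hbc : G.Adj b c) (hac : a ≠ c) : G.Adj a c := by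
  obtain ⟨f, -, h2⟩ := h
  rw [h2 a ha c hc hac, (h2 a ha b hb hab.ne).1 hab, (h2 b hb c hc hbc.ne).1 hbc]

lemma exists_clusterOn [Finite V]
    (h : ∀ a ∈ S, ∀ b ∈ S, ∀ c ∈ S, G.Adj a b → G.Adj b c → a ≠ c → G.Adj a c) :
    ∃ n, ClusterOn G S n := by
  classical
  -- Vertices outside `S` become singleton classes. They only add unused colours, which is harmless
  -- because `n` is free.
  let r : Setoid V :=
    { r := fun x y => x = y ∨ (x ∈ S ∧ y ∈ S ∧ G.Adj x y)
      iseqv := by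
        refine ⟨fun x => Or.inl rfl, ?_, ?_⟩
        · rintro x y (rfl | ⟨hx, hy, hxy⟩)
          · exact Or.inl rfl
          · exact Or.inr ⟨hy, hx, hxy.symm⟩
        · rintro x y z (rfl | ⟨hx, hy, hxy⟩) (rfl | ⟨hy', hz, hyz⟩)
          · exact Or.inl rfl
          · exact Or.inr ⟨hy', hz, hyz⟩
          · exact Or.inr ⟨hx, hy, hxy⟩
          · by_cases hxz : x = z
            · exact Or.inl hxz
            · exact Or.inr ⟨hx, hz, h x hx y hy z hz hxy hyz hxz⟩ }
  have := Fintype.ofFinite (Quotient r)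
  refine ⟨Fintype.card (Quotient r), ClusterOn.of_finset (fun x => Quotient.mk r x) Finset.univ
    (by simp) le_rfl fun u hu v hv huv => ?_⟩
  rw [Quotient.eq]
  change _ ↔ u = v ∨ (u ∈ S ∧ v ∈ S ∧ G.Adj u v)
  simp [huv, hu, hv]

lemma exists_induced_path_of_not_clusterOn [Finite V] (h : ¬ ∃ n, ClusterOn G S n) :
    ∃ p ∈ S, ∃ q ∈ S, ∃ r ∈ S, G.Adj p q ∧ G.Adj q r ∧ p ≠ r ∧ ¬ G.Adj p r := by
  by_contra hc
  push Not at hc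
  exact h (exists_clusterOn fun a ha b hb c hc' h1 h2 h3 => hc a ha b hb c hc' h1 h2 h3)

lemma ClusterOn.image_iff (e : G ↪g H) : ClusterOn H (e '' S) n ↔ ClusterOn G S n := by
  classical
  constructor
  · rintro ⟨f, h1, h2⟩
    refine ⟨f ∘ e, fun u hu => h1 _ (mem_image_of_mem _ hu), fun u hu v hv huv => ?_⟩
    rw [← e.map_adj_iff]
    exact h2 _ (mem_image_of_mem _ hu) _ (mem_image_of_mem _ hv) (e.injective.ne huv)
  · rintro ⟨f, h1, h2⟩
    refine ⟨Function.extend e f fun _ => 0, ?_, ?_⟩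
    · rintro _ ⟨u, hu, rfl⟩
      rw [e.injective.extend_apply]
      exact h1 u hu
    · rintro _ ⟨u, hu, rfl⟩ _ ⟨v, hv, rfl⟩ huv
      rw [e.injective.extend_apply, e.injective.extend_apply, e.map_adj_iff]
      exact h2 u hu v hv fun h => huv (by rw [h])

lemma MonoOn.image_iff (e : G ↪g H) : MonoOn H (e '' S) n ↔ MonoOn G S n := by
  constructor
  · rintro ⟨A, hA, h1, h2⟩
    refine ⟨e ⁻¹' A ∩ S, inter_subset_right, fun a ha b hb hab =>
      h1 _ ha.1 _ hb.1 (e.map_adj_iff.2 hab), (ClusterOn.image_iff e).1 (h2.mono ?_ le_rfl)⟩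
    rintro _ ⟨u, ⟨hu, hA'⟩, rfl⟩
    exact ⟨mem_image_of_mem _ hu, fun h => hA' ⟨h, hu⟩⟩
  · rintro ⟨A, hA, h1, h2⟩
    refine ⟨e '' A, image_mono hA, ?_, ?_⟩
    · rintro _ ⟨a, ha, rfl⟩ _ ⟨b, hb, rfl⟩ hab
      exact h1 a ha b hb (e.map_adj_iff.1 hab)
    · rw [← image_sdiff e.injective]
      exact (ClusterOn.image_iff e).2 h2

lemma PolarOn.image_iff (e : G ↪g H) : PolarOn H (e '' S) n ↔ PolarOn G S n := by
  constructor
  · rintro ⟨A, hA, h1, h2⟩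
    refine ⟨e ⁻¹' A ∩ S, inter_subset_right, fun a ha b hb c hc hab hbc hac =>
      h1 _ ha.1 _ hb.1 _ hc.1 (mt e.map_adj_iff.1 hab) (mt e.map_adj_iff.1 hbc)
        (e.map_adj_iff.2 hac), (ClusterOn.image_iff e).1 (h2.mono ?_ le_rfl)⟩
    rintro _ ⟨u, ⟨hu, hA'⟩, rfl⟩
    exact ⟨mem_image_of_mem _ hu, fun h => hA' ⟨h, hu⟩⟩
  · rintro ⟨A, hA, h1, h2⟩
    refine ⟨e '' A, image_mono hA, ?_, ?_⟩
    · rintro _ ⟨a, ha, rfl⟩ _ ⟨b, hb, rfl⟩ _ ⟨c, hc, rfl⟩ hab hbc hac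
      exact h1 a ha b hb c hc (mt e.map_adj_iff.2 hab) (mt e.map_adj_iff.2 hbc)
        (e.map_adj_iff.1 hac)
    · rw [← image_sdiff e.injective]
      exact (ClusterOn.image_iff e).2 h2

lemma image_compl_singleton (e : G ≃g H) (v : V) : e '' {v}ᶜ = {e v}ᶜ := by
  rw [image_compl_eq e.bijective, image_singleton]

lemma image_univ_iso (e : G ≃g H) : e '' univ = univ := by
  rw [image_univ, e.surjective.range_eq]

lemma clusterOn_univ_iso (e : G ≃g H) : ClusterOn H univ n ↔ ClusterOn G univ n := by
  rw [← image_univ_iso e]; exact ClusterOn.image_iff e.toEmbedding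

lemma monoOn_univ_iso (e : G ≃g H) : MonoOn H univ n ↔ MonoOn G univ n := by
  rw [← image_univ_iso e]; exact MonoOn.image_iff e.toEmbedding

lemma polarOn_univ_iso (e : G ≃g H) : PolarOn H univ n ↔ PolarOn G univ n := by
  rw [← image_univ_iso e]; exact PolarOn.image_iff e.toEmbedding

lemma clusterOn_compl_iso (e : G ≃g H) (v : V) : ClusterOn H {e v}ᶜ n ↔ ClusterOn G {v}ᶜ n := by
  rw [← image_compl_singleton e]; exact ClusterOn.image_iff e.toEmbedding

lemma monoOn_compl_iso (e : G ≃g H) (v : V) : MonoOn H {e v}ᶜ n ↔ MonoOn G {v}ᶜ n := by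
  rw [← image_compl_singleton e]; exact MonoOn.image_iff e.toEmbedding

lemma image_val_induce (S : Set V) :
    (SimpleGraph.Embedding.induce (G := G) S) '' univ = S := by
  ext x; simp [SimpleGraph.Embedding.induce]

lemma clusterOn_induce : ClusterOn (G.induce S) univ n ↔ ClusterOn G S n := by
  conv_rhs => rw [← image_val_induce (G := G) S]
  exact (ClusterOn.image_iff _).symm

lemma monoOn_induce : MonoOn (G.induce S) univ n ↔ MonoOn G S n := by
  conv_rhs => rw [← image_val_induce (G := G) S]
  exact (MonoOn.image_iff _).symm

lemma polarOn_induce : PolarOn (G.induce S) univ n ↔ PolarOn G S n := by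
  conv_rhs => rw [← image_val_induce (G := G) S]
  exact (PolarOn.image_iff _).symm

end Basic

/-! ### From the stated definitions to colourings of vertex sets -/

section Translation

variable {V W : Type*} {G : SimpleGraph V} {H : SimpleGraph W} {n : ℕ}

lemma nonempty_embedding_of_fin {F : SimpleGraph (Fin n)} (f : Fin n → V)
    (hne : ∀ i j, i < j → f i ≠ f j) (h : ∀ i j, i < j → (G.Adj (f i) (f j) ↔ F.Adj i j)) :
    Nonempty (F ↪g G) := by
  refine ⟨⟨⟨f, fun i j hij => ?_⟩, fun {i j} => ?_⟩⟩
  · rcases lt_trichotomy i j with h' | h' | h'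
    · exact absurd hij (hne i j h')
    · exact h'
    · exact absurd hij.symm (hne j i h')
  · change G.Adj (f i) (f j) ↔ _
    rcases lt_trichotomy i j with h' | rfl | h'
    · exact h i j h'
    · simp
    · rw [G.adj_comm, F.adj_comm]
      exact h j i h'

/-- The adjacency pattern alone forces the four vertices to be distinct. -/
lemma isCograph_iff : IsCograph G ↔ ∀ a b c d, G.Adj a b → G.Adj b c → G.Adj c d →
    ¬ G.Adj a c → ¬ G.Adj a d → ¬ G.Adj b d → False := by
  constructor
  · intro h a b c d hab hbc hcd hac had hbd
    have h1 : a ≠ c := by rintro rfl; exact had hcd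
    have h2 : a ≠ d := by rintro rfl; exact hac hcd.symm
    have h3 : b ≠ d := by rintro rfl; exact had hab
    refine h (nonempty_embedding_of_fin ![a, b, c, d] (fun x y hxy => ?_) fun x y hxy => ?_)
    · fin_cases x <;> fin_cases y <;> simp [hab.ne, hbc.ne, hcd.ne, h1, h2, h3] at hxy ⊢
    · fin_cases x <;> fin_cases y <;>
        simp [SimpleGraph.pathGraph_adj, hab, hbc, hcd, hac, had, hbd] at hxy ⊢
  · rintro h ⟨e⟩
    refine h (e 0) (e 1) (e 2) (e 3) ?_ ?_ ?_ ?_ ?_ ?_ <;> rw [e.map_adj_iff] <;>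
      simp [SimpleGraph.pathGraph_adj]

lemma IsCograph.comap (h : IsCograph H) (e : G ↪g H) : IsCograph G := by
  rintro ⟨f⟩
  exact h ⟨e.comp f⟩

lemma isCluster_iff : IsCluster G ↔
    ∀ a b c, G.Adj a b → G.Adj b c → a ≠ c → G.Adj a c := by
  constructor
  · intro h a b c hab hbc hac
    by_contra hn
    exact h.trans a b c (fun h' => h'.2 hab) (fun h' => h'.2 hbc) ⟨hac, hn⟩
  · refine fun h => ⟨fun a b c hab hbc hac => ?_⟩
    rw [SimpleGraph.compl_adj, not_and_not_right] at hab hbc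
    by_cases h1 : a = b
    · subst h1; exact hac.2 (hbc hac.1)
    by_cases h2 : b = c
    · subst h2; exact hac.2 (hab hac.1)
    exact hac.2 (h a b c (hab h1) (hbc h2) hac.1)

lemma isClusterLE_coe_iff [Finite V] : IsClusterLE (n : ℕ∞) G ↔ ClusterOn G univ n := by
  classical
  have := Fintype.ofFinite G.ConnectedComponent
  constructor
  · rintro ⟨h, hn⟩
    rw [isCluster_iff] at h
    refine ClusterOn.of_finset (fun v => G.connectedComponentMk v) Finset.univ (by simp) ?_ ?_
    · rw [ENat.card_eq_coe_fintype_card] at hn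
      exact_mod_cast hn
    · intro u _ v _ huv
      rw [SimpleGraph.ConnectedComponent.eq]
      refine ⟨fun h => h.reachable, fun hr => ?_⟩
      -- In a cluster a walk shortcuts to a single edge.
      have key : ∀ {x y : V}, G.Walk x y → x = y ∨ G.Adj x y := by
        intro x y p
        induction p with
        | nil => exact Or.inl rfl
        | @cons x y z hxy p ih =>
          rcases ih with rfl | ih
          · exact Or.inr hxy
          · by_cases hxz : x = z
            · exact Or.inl hxz
            · exact Or.inr (h x y z hxy ih hxz)
      exact hr.elim fun p => (key p).resolve_left huv
  · intro hc
    refine ⟨isCluster_iff.2 fun a b c => hc.adj_trans (mem_univ a) (mem_univ b) (mem_univ c), ?_⟩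
    obtain ⟨f, h1, h2⟩ := hc
    have hf : ∀ x y : V, G.Reachable x y ↔ f x = f y := by
      intro x y
      constructor
      · rintro ⟨p⟩
        induction p with
        | nil => rfl
        | cons h p ih => rw [← ih, (h2 _ trivial _ trivial h.ne).1 h]
      · intro hxy
        by_cases hne : x = y
        · subst hne; rfl
        · exact ((h2 _ trivial _ trivial hne).2 hxy).reachable
    -- Reachable vertices have equal colours and conversely, so the colour of a representative
    -- determines the component.
    let g : G.ConnectedComponent → Fin n := fun c => ⟨f c.out, h1 _ trivial⟩
    have hg : Function.Injective g := by
      intro c d hcd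
      have := (hf c.out d.out).2 (Fin.mk.inj hcd)
      rw [← SimpleGraph.ConnectedComponent.eq] at this
      have hc : G.connectedComponentMk c.out = c := Quot.out_eq c
      have hd : G.connectedComponentMk d.out = d := Quot.out_eq d
      rw [← hc, ← hd, this]
    rw [ENat.card_eq_coe_fintype_card]
    have := Fintype.card_le_of_injective g hg
    rw [Fintype.card_fin] at this
    exact_mod_cast this

/-- Finiteness turns the bound `⊤` into an unspecified finite number of colours. -/
lemma isClusterLE_top_iff [Finite V] : IsClusterLE ⊤ G ↔ ∃ n, ClusterOn G univ n := by
  constructor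
  · rintro ⟨h, -⟩
    exact exists_clusterOn fun a _ b _ c _ => isCluster_iff.1 h a b c
  · rintro ⟨n, h⟩
    exact ⟨isCluster_iff.2 fun a b c => h.adj_trans (mem_univ a) (mem_univ b) (mem_univ c), le_top⟩

lemma isCompleteMultipartiteLE_one_iff :
    IsCompleteMultipartiteLE 1 G ↔ ∀ a b, ¬ G.Adj a b := by
  constructor
  · rintro ⟨h, hc⟩ a b
    rw [ENat.card_le_one_iff_subsingleton] at hc
    exact Quotient.exact (s := h.setoid) (Subsingleton.elim _ _)
  · intro h
    refine ⟨⟨fun a _ c _ _ => h a c⟩, ?_⟩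
    rw [ENat.card_le_one_iff_subsingleton]
    refine ⟨fun x y => ?_⟩
    induction x using Quotient.inductionOn
    induction y using Quotient.inductionOn
    exact Quotient.sound (h _ _)

lemma isCompleteMultipartiteLE_top_iff : IsCompleteMultipartiteLE ⊤ G ↔
    ∀ a b c, ¬ G.Adj a b → ¬ G.Adj b c → ¬ G.Adj a c :=
  ⟨fun ⟨h, _⟩ => h.trans, fun h => ⟨⟨h⟩, le_top⟩⟩

lemma isPolar_one_coe_iff [Finite V] : IsPolar 1 (n : ℕ∞) G ↔ MonoOn G univ n := by
  simp only [IsPolar, MonoOn, isCompleteMultipartiteLE_one_iff, isClusterLE_coe_iff,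
    clusterOn_induce, subset_univ, true_and, compl_eq_univ_sdiff]
  simp

lemma isPolar_one_top_iff [Finite V] : IsPolar 1 ⊤ G ↔ ∃ n, MonoOn G univ n := by
  simp only [IsPolar, MonoOn, isCompleteMultipartiteLE_one_iff, isClusterLE_top_iff,
    clusterOn_induce, subset_univ, true_and, compl_eq_univ_sdiff]
  simp only [SimpleGraph.comap_adj, Function.Embedding.subtype_apply, Subtype.forall]
  constructor
  · rintro ⟨A, h, n, h'⟩
    exact ⟨n, A, h, h'⟩
  · rintro ⟨n, A, h, h'⟩
    exact ⟨A, h, n, h'⟩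

lemma isPolar_top_coe_iff [Finite V] : IsPolar ⊤ (n : ℕ∞) G ↔ PolarOn G univ n := by
  simp only [IsPolar, PolarOn, isCompleteMultipartiteLE_top_iff, isClusterLE_coe_iff,
    clusterOn_induce, subset_univ, true_and, compl_eq_univ_sdiff]
  simp

/-- Polarity is hereditary, so minimality only has to be tested on vertex-deleted subgraphs. -/
lemma ne_univ_iff_subset_compl {S : Set V} : S ≠ univ ↔ ∃ v, S ⊆ {v}ᶜ := by
  simp [ne_univ_iff_exists_notMem]

lemma isCographMinimalObstruction_one_coe_iff [Finite V] :
    IsCographMinimalObstruction 1 (n : ℕ∞) G ↔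
      IsCograph G ∧ ¬ MonoOn G univ n ∧ ∀ v, MonoOn G {v}ᶜ n := by
  simp only [IsCographMinimalObstruction, isPolar_one_coe_iff, monoOn_induce,
    ne_univ_iff_subset_compl]
  exact and_congr_right fun _ => and_congr_right fun _ =>
    ⟨fun h v => h _ ⟨v, subset_rfl⟩, fun h S ⟨v, hv⟩ => (h v).mono hv le_rfl⟩

lemma isCographMinimalObstruction_one_top_iff [Finite V] :
    IsCographMinimalObstruction 1 ⊤ G ↔
      IsCograph G ∧ (¬ ∃ n, MonoOn G univ n) ∧ ∀ v, ∃ n, MonoOn G {v}ᶜ n := by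
  simp only [IsCographMinimalObstruction, isPolar_one_top_iff, monoOn_induce,
    ne_univ_iff_subset_compl]
  exact and_congr_right fun _ => and_congr_right fun _ =>
    ⟨fun h v => h _ ⟨v, subset_rfl⟩, fun h S ⟨v, hv⟩ => (h v).imp fun _ h => h.mono hv le_rfl⟩

lemma isCographMinimalObstruction_top_coe_iff [Finite V] :
    IsCographMinimalObstruction ⊤ (n : ℕ∞) G ↔
      IsCograph G ∧ ¬ PolarOn G univ n ∧ ∀ v, PolarOn G {v}ᶜ n := by
  simp only [IsCographMinimalObstruction, isPolar_top_coe_iff, polarOn_induce,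
    ne_univ_iff_subset_compl]
  exact and_congr_right fun _ => and_congr_right fun _ =>
    ⟨fun h v => h _ ⟨v, subset_rfl⟩, fun h S ⟨v, hv⟩ => (h v).mono hv le_rfl⟩

end Translation

/-! ### Polarity of disjoint unions -/

section Sum

variable {V W : Type*} {X : SimpleGraph V} {Y : SimpleGraph W} {S : Set (V ⊕ W)} {n : ℕ}

/-- No edge joins the summands, so they share no colour and the numbers of colours in use add up. -/
lemma clusterOn_sum : ClusterOn (X ⊕g Y) S n ↔ ∃ i j, i + j ≤ n ∧
    ClusterOn X (Sum.inl ⁻¹' S) i ∧ ClusterOn Y (Sum.inr ⁻¹' S) j := by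
  classical
  constructor
  · rintro ⟨f, h1, h2⟩
    let F₁ := (Finset.range n).filter fun c => ∃ u, Sum.inl u ∈ S ∧ f (Sum.inl u) = c
    let F₂ := (Finset.range n).filter fun c => ∃ u, Sum.inr u ∈ S ∧ f (Sum.inr u) = c
    refine ⟨F₁.card, F₂.card, ?_, ?_, ?_⟩
    · have hd : Disjoint F₁ F₂ := by
        rw [Finset.disjoint_left]
        intro c h h'
        obtain ⟨u, hu, hu'⟩ := (Finset.mem_filter.1 h).2
        obtain ⟨w, hw, hw'⟩ := (Finset.mem_filter.1 h').2
        have := (h2 _ hu _ hw (by simp)).2 (hu'.trans hw'.symm)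
        simp at this
      rw [← Finset.card_union_of_disjoint hd]
      conv_rhs => rw [← Finset.card_range n]
      exact Finset.card_le_card (Finset.union_subset (Finset.filter_subset _ _)
        (Finset.filter_subset _ _))
    · refine ClusterOn.of_finset (fun u => f (Sum.inl u)) F₁ (fun u hu => ?_) le_rfl
        fun u hu v hv huv => ?_
      · exact Finset.mem_filter.2 ⟨Finset.mem_range.2 (h1 _ hu), u, hu, rfl⟩
      · rw [← h2 _ hu _ hv (by simpa using huv), SimpleGraph.sum_adj_inl]
    · refine ClusterOn.of_finset (fun u => f (Sum.inr u)) F₂ (fun u hu => ?_) le_rfl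
        fun u hu v hv huv => ?_
      · exact Finset.mem_filter.2 ⟨Finset.mem_range.2 (h1 _ hu), u, hu, rfl⟩
      · rw [← h2 _ hu _ hv (by simpa using huv), SimpleGraph.sum_adj_inr]
  · rintro ⟨i, j, hij, ⟨f, f1, f2⟩, ⟨g, g1, g2⟩⟩
    refine ⟨Sum.elim f fun w => i + g w, ?_, ?_⟩
    · rintro (u | u) hu
      · have := f1 u hu; simp; omega
      · have := g1 u hu; simp; omega
    · rintro (u | u) hu (v | v) hv huv
      · simpa using f2 u hu v hv (by simpa using huv)
      · have := f1 u hu; simp; omega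
      · have := f1 v hv; simp; omega
      · simpa using g2 u hu v hv (by simpa using huv)

/-- Independent sets of the two summands unite freely; only the colours of the clusters have to be
shared out. -/
lemma monoOn_sum : MonoOn (X ⊕g Y) S n ↔ ∃ i j, i + j ≤ n ∧
    MonoOn X (Sum.inl ⁻¹' S) i ∧ MonoOn Y (Sum.inr ⁻¹' S) j := by
  constructor
  · rintro ⟨A, hA, h1, h2⟩
    obtain ⟨i, j, hij, hi, hj⟩ := clusterOn_sum.1 h2
    refine ⟨i, j, hij, ⟨Sum.inl ⁻¹' A, preimage_mono hA, fun a ha b hb hab => ?_, hi⟩,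
      ⟨Sum.inr ⁻¹' A, preimage_mono hA, fun a ha b hb hab => ?_, hj⟩⟩
    · exact h1 _ ha _ hb (by simpa using hab)
    · exact h1 _ ha _ hb (by simpa using hab)
  · rintro ⟨i, j, hij, ⟨A, hA, a1, a2⟩, ⟨B, hB, b1, b2⟩⟩
    refine ⟨Sum.inl '' A ∪ Sum.inr '' B, ?_, ?_, clusterOn_sum.2 ⟨i, j, hij, ?_, ?_⟩⟩
    · rintro _ (⟨a, ha, rfl⟩ | ⟨b, hb, rfl⟩)
      · exact hA ha
      · exact hB hb
    · rintro _ (⟨a, ha, rfl⟩ | ⟨a, ha, rfl⟩) _ (⟨b, hb, rfl⟩ | ⟨b, hb, rfl⟩)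
      · simpa using a1 a ha b hb
      · simp
      · simp
      · simpa using b1 a ha b hb
    · refine a2.mono ?_ le_rfl
      rintro x ⟨hx, hx'⟩
      exact ⟨hx, fun h => hx' (Or.inl ⟨x, h, rfl⟩)⟩
    · refine b2.mono ?_ le_rfl
      rintro x ⟨hx, hx'⟩
      exact ⟨hx, fun h => hx' (Or.inr ⟨x, h, rfl⟩)⟩

lemma polarOn_sum_of_left {i j : ℕ} (hij : i + j ≤ n) (hX : PolarOn X (Sum.inl ⁻¹' S) i)
    (hY : ClusterOn Y (Sum.inr ⁻¹' S) j) : PolarOn (X ⊕g Y) S n := by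
  obtain ⟨A, hA, a1, a2⟩ := hX
  refine ⟨Sum.inl '' A, ?_, ?_, clusterOn_sum.2 ⟨i, j, hij, ?_, ?_⟩⟩
  · rintro _ ⟨a, ha, rfl⟩
    exact hA ha
  · rintro _ ⟨a, ha, rfl⟩ _ ⟨b, hb, rfl⟩ _ ⟨c, hc, rfl⟩
    simpa using a1 a ha b hb c hc
  · refine a2.mono ?_ le_rfl
    rintro x ⟨hx, hx'⟩
    exact ⟨hx, fun h => hx' ⟨x, h, rfl⟩⟩
  · exact hY.mono (fun x hx => hx.1) le_rfl

lemma polarOn_sum_comm :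
    PolarOn (X ⊕g Y) S n ↔ PolarOn (Y ⊕g X) (Sum.swap '' S) n :=
  (PolarOn.image_iff (SimpleGraph.Iso.sumComm (G := X) (H := Y)).toEmbedding).symm

lemma polarOn_sum_of_right {i j : ℕ} (hij : i + j ≤ n) (hX : ClusterOn X (Sum.inl ⁻¹' S) i)
    (hY : PolarOn Y (Sum.inr ⁻¹' S) j) : PolarOn (X ⊕g Y) S n := by
  rw [polarOn_sum_comm]
  refine polarOn_sum_of_left (i := j) (j := i) (by omega) ?_ ?_
  · convert hY using 1; ext; simp
  · convert hX using 1; ext; simp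

/-- A polar partition of a disjoint union either has an independent first part, or its first part
lies in one of the two summands. -/
lemma PolarOn.sum_cases (h : PolarOn (X ⊕g Y) S n) : MonoOn (X ⊕g Y) S n ∨
    (∃ i j, i + j ≤ n ∧ PolarOn X (Sum.inl ⁻¹' S) i ∧ ClusterOn Y (Sum.inr ⁻¹' S) j) ∨
    (∃ i j, i + j ≤ n ∧ ClusterOn X (Sum.inl ⁻¹' S) i ∧ PolarOn Y (Sum.inr ⁻¹' S) j) := by
  obtain ⟨A, hA, h1, h2⟩ := h
  by_cases hind : ∀ a ∈ A, ∀ b ∈ A, ¬ (X ⊕g Y).Adj a b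
  · exact Or.inl ⟨A, hA, hind, h2⟩
  right
  push Not at hind
  obtain ⟨i, j, hij, hi, hj⟩ := clusterOn_sum.1 h2
  obtain ⟨a | a, ha, b | b, hb, hab⟩ := hind
  · left
    refine ⟨i, j, hij, ⟨Sum.inl ⁻¹' A, preimage_mono hA, fun a ha b hb c hc => ?_, hi⟩,
      hj.mono ?_ le_rfl⟩
    · simpa using h1 _ ha _ hb _ hc
    -- A vertex of `A` in the other summand would be nonadjacent to both ends of the edge `ab`,
    -- against transitivity of nonadjacency in `A`.
    · refine fun w hw => ⟨hw, fun hw' => h1 _ ha _ hw' _ hb ?_ ?_ hab⟩ <;> simp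
  · simp at hab
  · simp at hab
  · right
    refine ⟨i, j, hij, hi.mono ?_ le_rfl, ⟨Sum.inr ⁻¹' A, preimage_mono hA,
      fun a ha b hb c hc => ?_, hj⟩⟩
    · refine fun w hw => ⟨hw, fun hw' => h1 _ ha _ hw' _ hb ?_ ?_ hab⟩ <;> simp
    · simpa using h1 _ ha _ hb _ hc

lemma isCograph_sum : IsCograph (X ⊕g Y) ↔ IsCograph X ∧ IsCograph Y := by
  constructor
  · exact fun h => ⟨h.comap SimpleGraph.Embedding.sumInl, h.comap SimpleGraph.Embedding.sumInr⟩
  · rintro ⟨hX, hY⟩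
    rw [isCograph_iff] at *
    rintro (a | a) (b | b) (c | c) (d | d) <;>
      simp only [SimpleGraph.sum_adj, false_imp_iff, imp_true_iff]
    · exact hX a b c d
    · exact hY a b c d

end Sum

/-! ### The path `P3` and its vertex-deleted subgraphs -/

section Small

variable {V : Type*} {G : SimpleGraph V} {S : Set V} {n : ℕ}

lemma MonoOn.pos (h : MonoOn G S n) {a b : V} (ha : a ∈ S) (hb : b ∈ S) (hab : G.Adj a b) :
    1 ≤ n := by
  obtain ⟨A, -, h1, f, hf, -⟩ := h
  by_contra hn
  obtain rfl : n = 0 := by omega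
  have key : ∀ x ∈ S, x ∈ A := fun x hx => by
    by_contra hxA
    exact absurd (hf x ⟨hx, hxA⟩) (Nat.not_lt_zero _)
  exact h1 a (key a ha) b (key b hb) hab

lemma ClusterOn.two_le (h : ClusterOn G S n) {a b : V} (ha : a ∈ S) (hb : b ∈ S) (hne : a ≠ b)
    (hab : ¬ G.Adj a b) : 2 ≤ n := by
  obtain ⟨f, h1, h2⟩ := h
  have := h1 a ha
  have := h1 b hb
  have := mt (h2 a ha b hb hne).2 hab
  omega

/-- An induced path on three vertices shows that a set does not induce a cluster. -/
lemma not_clusterOn_of_path {a b c : V} (ha : a ∈ S) (hb : b ∈ S) (hc : c ∈ S)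
    (hab : G.Adj a b) (hbc : G.Adj b c) (hne : a ≠ c) (hac : ¬ G.Adj a c) (n : ℕ) :
    ¬ ClusterOn G S n := fun h => hac (h.adj_trans ha hb hc hab hbc hne)

lemma P3_adj_iff {a b : Fin 3} : P3.Adj a b ↔ (a = 1 ∧ b ≠ 1) ∨ (a ≠ 1 ∧ b = 1) := by
  fin_cases a <;> fin_cases b <;> simp [SimpleGraph.pathGraph_adj]

lemma isCograph_P3 : IsCograph P3 := by
  rw [isCograph_iff]
  intro a b c d
  simp only [P3_adj_iff]
  tauto

lemma monoOn_P3 : MonoOn P3 univ 1 := by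
  refine ⟨{1}ᶜ, subset_univ _, ?_, fun _ => 0, by simp, ?_⟩
  · intro a ha b hb
    simp_all [P3_adj_iff]
  · intro a ha b hb hab
    simp_all

lemma one_le_of_monoOn_P3 (h : MonoOn P3 univ n) : 1 ≤ n :=
  h.pos (a := 0) (b := 1) trivial trivial (by simp [P3_adj_iff])

lemma not_clusterOn_P3 : ¬ ClusterOn P3 univ n :=
  not_clusterOn_of_path (a := 0) (b := 1) (c := 2) (mem_univ _) (mem_univ _) (mem_univ _) (by simp [P3_adj_iff])
    (by simp [P3_adj_iff]) (by simp) (by simp [P3_adj_iff]) n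

lemma polarOn_P3 : PolarOn P3 univ 0 := by
  refine ⟨univ, subset_rfl, ?_, by simpa using clusterOn_empty⟩
  intro a _ b _ c _
  simp only [P3_adj_iff]
  tauto

lemma clusterOn_P3_compl_end {v : Fin 3} (hv : v ≠ 1) : ClusterOn P3 {v}ᶜ 1 := by
  refine ⟨fun _ => 0, by simp, ?_⟩
  intro a ha b hb hab
  fin_cases v <;> fin_cases a <;> fin_cases b <;> simp_all [P3_adj_iff]

lemma one_le_of_monoOn_P3_compl_end {v : Fin 3} (hv : v ≠ 1) (h : MonoOn P3 {v}ᶜ n) : 1 ≤ n := by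
  fin_cases v
  · exact h.pos (a := 1) (b := 2) (by simp) (by simp) (by simp [P3_adj_iff])
  · simp at hv
  · exact h.pos (a := 0) (b := 1) (by simp) (by simp) (by simp [P3_adj_iff])

lemma monoOn_P3_compl_center : MonoOn P3 {1}ᶜ 0 := by
  refine ⟨{1}ᶜ, subset_rfl, ?_, by simpa using clusterOn_empty⟩
  intro a ha b hb
  simp_all [P3_adj_iff]

lemma clusterOn_P3_compl_center : ClusterOn P3 {1}ᶜ 2 := by
  refine ⟨fun v => v / 2, ?_, ?_⟩
  · intro u _; fin_cases u <;> simp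
  · intro a ha b hb
    fin_cases a <;> fin_cases b <;> simp_all [P3_adj_iff]

lemma two_le_of_clusterOn_P3_compl_center (h : ClusterOn P3 {1}ᶜ n) : 2 ≤ n :=
  h.two_le (a := 0) (b := 2) (by simp) (by simp) (by simp) (by simp [P3_adj_iff])

end Small

/-! ### Reduction from `P3 + H` to conditions on `H` -/

/-- The conditions on `H` under which `P₃ + H` is a cograph minimal `(∞, m + 2)`-polar
obstruction. -/
structure IsResidue {V : Type*} (m : ℕ) (H : SimpleGraph V) : Prop where
  isCograph : IsCograph H
  not_monoOn : ¬ MonoOn H univ (m + 1)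
  not_clusterOn : ¬ ClusterOn H univ (m + 2)
  polarOn : PolarOn H univ (m + 1)
  monoOn_or : MonoOn H univ (m + 2) ∨ PolarOn H univ m
  compl : ∀ v, MonoOn H {v}ᶜ (m + 1) ∨ ClusterOn H {v}ᶜ (m + 2)

section Preimage

variable {V W : Type*}

lemma preimage_inl_compl_inl (v : V) :
    Sum.inl ⁻¹' ({Sum.inl v}ᶜ : Set (V ⊕ W)) = {v}ᶜ := by ext; simp

lemma preimage_inr_compl_inl (v : V) :
    Sum.inr ⁻¹' ({Sum.inl v}ᶜ : Set (V ⊕ W)) = univ := by ext; simp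

lemma preimage_inl_compl_inr (w : W) :
    Sum.inl ⁻¹' ({Sum.inr w}ᶜ : Set (V ⊕ W)) = univ := by ext; simp

lemma preimage_inr_compl_inr (w : W) :
    Sum.inr ⁻¹' ({Sum.inr w}ᶜ : Set (V ⊕ W)) = {w}ᶜ := by ext; simp

end Preimage

section Residue

variable {V W : Type*} {H : SimpleGraph W} {G : SimpleGraph V} {m k : ℕ}

lemma IsResidue.of_iso (e : G ≃g H) (h : IsResidue m H) : IsResidue m G := by
  refine ⟨h.isCograph.comap e.toEmbedding, ?_, ?_, ?_, ?_, fun v => ?_⟩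
  · rw [← monoOn_univ_iso e]; exact h.not_monoOn
  · rw [← clusterOn_univ_iso e]; exact h.not_clusterOn
  · rw [← polarOn_univ_iso e]; exact h.polarOn
  · rw [← monoOn_univ_iso e, ← polarOn_univ_iso e]; exact h.monoOn_or
  · rw [← monoOn_compl_iso e, ← clusterOn_compl_iso e]; exact h.compl _

/-- If the first part is independent, `P3` takes one colour and leaves `k`. Otherwise the first part
must lie in `P3`, which it can absorb entirely, leaving all `k + 1` colours for `H`. -/
lemma polarOn_P3_sum {T : Set W} {S : Set (Fin 3 ⊕ W)} (hl : Sum.inl ⁻¹' S = univ)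
    (hr : Sum.inr ⁻¹' S = T) :
    PolarOn (P3 ⊕g H) S (k + 1) ↔ MonoOn H T k ∨ ClusterOn H T (k + 1) := by
  subst hr
  constructor
  · intro h
    rcases h.sum_cases with h | ⟨i, j, hij, hi, hj⟩ | ⟨i, j, hij, hi, hj⟩
    · obtain ⟨i, j, hij, hi, hj⟩ := monoOn_sum.1 h
      rw [hl] at hi
      have := one_le_of_monoOn_P3 hi
      exact Or.inl (hj.mono subset_rfl (by omega))
    · exact Or.inr (hj.mono subset_rfl (by omega))
    · rw [hl] at hi
      exact absurd hi not_clusterOn_P3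
  · rintro (h | h)
    · exact (monoOn_sum.2 ⟨1, k, by omega, hl ▸ monoOn_P3, h⟩).polarOn
    · exact polarOn_sum_of_left (i := 0) (j := k + 1) (by omega) (hl ▸ polarOn_P3) h

/-- The two negations in `IsResidue` say that the whole graph is not polar. Deleting an end of the
path leaves `K₂`, which costs one colour and gives `polarOn`. Deleting the centre leaves two
isolated vertices, free beside an independent part and worth two colours in a cluster, which gives
`monoOn_or`. Deleting a vertex of `H` gives `compl`. -/
lemma isCographMinimalObstruction_P3_sum [Finite W] :
    IsCographMinimalObstruction ⊤ ((m + 2 : ℕ) : ℕ∞) (P3 ⊕g H) ↔ IsResidue m H := by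
  rw [isCographMinimalObstruction_top_coe_iff, isCograph_sum, polarOn_P3_sum rfl rfl]
  rw [preimage_univ]
  constructor
  · rintro ⟨⟨-, hc⟩, hN, hV⟩
    push Not at hN
    refine ⟨hc, hN.1, hN.2, ?_, ?_, fun v => ?_⟩
    · have h0 := hV (Sum.inl 0)
      rcases h0.sum_cases with h | ⟨i, j, hij, hi, hj⟩ | ⟨i, j, hij, hi, hj⟩
      · obtain ⟨i, j, hij, hi, hj⟩ := monoOn_sum.1 h
        rw [preimage_inl_compl_inl] at hi
        rw [preimage_inr_compl_inl] at hj
        have := one_le_of_monoOn_P3_compl_end (by simp) hi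
        exact hj.polarOn.mono subset_rfl (by omega)
      · rw [preimage_inr_compl_inl] at hj
        exact absurd (hj.mono subset_rfl (by omega)) hN.2
      · rw [preimage_inl_compl_inl] at hi
        rw [preimage_inr_compl_inl] at hj
        have := one_le_of_monoOn_P3_compl_end (by simp) hi.monoOn
        exact hj.mono subset_rfl (by omega)
    · have h0 := hV (Sum.inl 1)
      rcases h0.sum_cases with h | ⟨i, j, hij, hi, hj⟩ | ⟨i, j, hij, hi, hj⟩
      · obtain ⟨i, j, hij, hi, hj⟩ := monoOn_sum.1 h
        rw [preimage_inr_compl_inl] at hj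
        exact Or.inl (hj.mono subset_rfl (by omega))
      · rw [preimage_inr_compl_inl] at hj
        exact absurd (hj.mono subset_rfl (by omega)) hN.2
      · rw [preimage_inl_compl_inl] at hi
        rw [preimage_inr_compl_inl] at hj
        have := two_le_of_clusterOn_P3_compl_center hi
        exact Or.inr (hj.mono subset_rfl (by omega))
    · exact (polarOn_P3_sum (preimage_inl_compl_inr v) (preimage_inr_compl_inr v)).1 (hV _)
  · intro h
    refine ⟨⟨isCograph_P3, h.isCograph⟩, ?_, ?_⟩
    · push Not
      exact ⟨h.not_monoOn, h.not_clusterOn⟩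
    rintro (v | w)
    · by_cases hv : v = 1
      · subst hv
        rcases h.monoOn_or with h | h
        · refine (monoOn_sum.2 ⟨0, m + 2, by omega, ?_, ?_⟩).polarOn
          · rw [preimage_inl_compl_inl]; exact monoOn_P3_compl_center
          · rw [preimage_inr_compl_inl]; exact h
        · refine polarOn_sum_of_right (i := 2) (j := m) (by omega) ?_ ?_
          · rw [preimage_inl_compl_inl]; exact clusterOn_P3_compl_center
          · rw [preimage_inr_compl_inl]; exact h
      · refine polarOn_sum_of_right (i := 1) (j := m + 1) (by omega) ?_ ?_
        · rw [preimage_inl_compl_inl]; exact clusterOn_P3_compl_end hv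
        · rw [preimage_inr_compl_inl]; exact h.polarOn
    · exact (polarOn_P3_sum (preimage_inl_compl_inr w) (preimage_inr_compl_inr w)).2 (h.compl w)

lemma IsCographMinimalObstruction.of_iso [Finite V] [Finite W] (e : G ≃g H) {n : ℕ}
    (h : IsCographMinimalObstruction ⊤ (n : ℕ∞) H) :
    IsCographMinimalObstruction ⊤ (n : ℕ∞) G := by
  revert h
  rw [isCographMinimalObstruction_top_coe_iff, isCographMinimalObstruction_top_coe_iff]
  rintro ⟨h1, h2, h3⟩
  refine ⟨h1.comap e.toEmbedding, by rwa [← polarOn_univ_iso e], fun v => ?_⟩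
  refine (PolarOn.image_iff e.toEmbedding).1 ?_
  change PolarOn H (e '' {v}ᶜ) n
  rw [image_compl_singleton]
  exact h3 _

/-- A graph is the disjoint union of a component and the rest. -/
lemma nonempty_sum_component_iso (C : G.ConnectedComponent) :
    Nonempty (G ≃g G.induce C.suppᶜ ⊕g C.toSimpleGraph) := by
  classical
  refine ⟨SimpleGraph.Iso.symm
    ⟨(Equiv.sumComm _ _).trans (Equiv.Set.sumCompl C.supp), ?_⟩⟩
  have key : ∀ {x y : V}, x ∈ C.supp → y ∉ C.supp → ¬ G.Adj x y := by
    intro x y hx hy h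
    apply hy
    rw [SimpleGraph.ConnectedComponent.mem_supp_iff] at hx ⊢
    rw [← hx, SimpleGraph.ConnectedComponent.eq]
    exact h.symm.reachable
  rintro (x | x) (y | y)
  · change G.Adj x y ↔ _
    simp
  · change G.Adj x y ↔ _
    simpa using fun h => key y.2 x.2 h.symm
  · change G.Adj x y ↔ _
    simpa using key x.2 y.2
  · change G.Adj x y ↔ _
    simp [SimpleGraph.ConnectedComponent.toSimpleGraph]

end Residue

/-! ### Join and union decomposition of cographs; split cographs -/

section Decomposition

variable {V : Type*} {G : SimpleGraph V} {S T X Y : Set V} {n : ℕ}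

lemma IsCograph.compl (h : IsCograph G) : IsCograph Gᶜ := by
  rw [isCograph_iff] at *
  intro a b c d hab hbc hcd hac had hbd
  have h1 : a ≠ c := by rintro rfl; exact had hcd
  have h2 : a ≠ d := by rintro rfl; exact hac hcd.symm
  have h3 : b ≠ d := by rintro rfl; exact had hab
  simp only [SimpleGraph.compl_adj, not_and_not_right] at *
  -- The path on four vertices is self-complementary: the complement of `a b c d` is `c a d b`.
  exact h c a d b (hac h1).symm (had h2) (hbd h3).symm hcd.2 (fun h => hbc.2 h.symm) hab.2

/-- Adding a vertex to a disconnected vertex set of a cograph. -/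
lemma IsCograph.exists_partition_insert (h : IsCograph G) {v : V} (hX : X.Nonempty)
    (hY : Y.Nonempty) (hd : Disjoint X Y) (hvX : v ∉ X) (hvY : v ∉ Y)
    (hXY : ∀ x ∈ X, ∀ y ∈ Y, ¬ G.Adj x y) :
    ∃ X' Y' : Set V, X'.Nonempty ∧ Y'.Nonempty ∧ Disjoint X' Y' ∧ X' ∪ Y' = insert v (X ∪ Y) ∧
      ((∀ x ∈ X', ∀ y ∈ Y', G.Adj x y) ∨ ∀ x ∈ X', ∀ y ∈ Y', ¬ G.Adj x y) := by
  by_contra hcon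
  -- If no partition exists, the enlarged set is connected, so some edge leaves each such `Z`.
  have key : ∀ Z ⊆ X ∪ Y, Z.Nonempty → ∃ z ∈ Z, ∃ w ∈ insert v (X ∪ Y), w ∉ Z ∧ G.Adj z w := by
    intro Z hZ hZne
    by_contra hc
    push Not at hc
    refine hcon ⟨Z, insert v (X ∪ Y) \ Z, hZne, ⟨v, mem_insert _ _, fun hv => ?_⟩,
      disjoint_sdiff_right, union_sdiff_cancel (hZ.trans (subset_insert _ _)),
      Or.inr fun x hx y hy => hc x hx y hy.1 hy.2⟩
    rcases hZ hv with h | h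
    · exact hvX h
    · exact hvY h
  have side : ∀ {X Y : Set V}, X.Nonempty → Disjoint X Y → (∀ x ∈ X, ∀ y ∈ Y, ¬ G.Adj x y) →
      (∀ Z ⊆ X ∪ Y, Z.Nonempty → ∃ z ∈ Z, ∃ w ∈ insert v (X ∪ Y), w ∉ Z ∧ G.Adj z w) →
      ∃ x ∈ X, G.Adj x v := by
    intro X Y hX hd hXY key
    obtain ⟨z, hz, w, rfl | hw | hw, hwZ, hzw⟩ := key X subset_union_left hX
    · exact ⟨z, hz, hzw⟩
    · exact absurd hw hwZ
    · exact absurd hzw (hXY z hz w hw)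
  have main : ∀ {X Y : Set V}, Disjoint X Y → (∀ x ∈ X, ∀ y ∈ Y, ¬ G.Adj x y) →
      (∀ Z ⊆ X ∪ Y, Z.Nonempty → ∃ z ∈ Z, ∃ w ∈ insert v (X ∪ Y), w ∉ Z ∧ G.Adj z w) →
      (∃ y ∈ Y, G.Adj y v) → ∀ x ∈ X, G.Adj v x := by
    rintro X Y hd hXY key ⟨z, hz, hzv⟩ x hx
    by_contra hvx
    -- Let `Z` be the set of non-neighbours of `v` in `X`. An edge `yw` leaving `Z` ends at a
    -- neighbour of `v`, and `y, w, v, z` is an induced path.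
    obtain ⟨y, ⟨hy, hyv⟩, w, hw, hwZ, hyw⟩ := key {x | x ∈ X ∧ ¬ G.Adj v x}
      (fun x hx => Or.inl hx.1) ⟨x, hx, hvx⟩
    rcases hw with rfl | hw | hw
    · exact hyv hyw.symm
    · have hvw : G.Adj v w := by
        by_contra hn
        exact hwZ ⟨hw, hn⟩
      exact (isCograph_iff.1 h) y w v z hyw hvw.symm hzv.symm (fun h => hyv h.symm)
        (hXY y hy z hz) (hXY w hw z hz)
    · exact hXY y hy w hw hyw
  have hYX : ∀ x ∈ Y, ∀ y ∈ X, ¬ G.Adj x y := fun x hx y hy h => hXY y hy x hx h.symm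
  have key' : ∀ Z ⊆ Y ∪ X, Z.Nonempty →
      ∃ z ∈ Z, ∃ w ∈ insert v (Y ∪ X), w ∉ Z ∧ G.Adj z w := by
    rw [union_comm]; exact key
  have h1 := main hd hXY key (side hY hd.symm hYX key')
  have h2 := main hd.symm hYX key' (side hX hd hXY key)
  refine hcon ⟨{v}, X ∪ Y, singleton_nonempty v, hX.inl, ?_, singleton_union, Or.inl ?_⟩
  · rw [disjoint_singleton_left]
    exact fun h => h.elim hvX hvY
  · rintro _ rfl y (hy | hy)
    · exact h1 y hy
    · exact h2 y hy

/-- Every set of at least two vertices of a cograph induces a disjoint union or a join. -/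
lemma IsCograph.exists_partition [Finite V] (h : IsCograph G) (S : Set V) (hS : S.Nontrivial) :
    ∃ X Y : Set V, X.Nonempty ∧ Y.Nonempty ∧ Disjoint X Y ∧ X ∪ Y = S ∧
      ((∀ x ∈ X, ∀ y ∈ Y, G.Adj x y) ∨ ∀ x ∈ X, ∀ y ∈ Y, ¬ G.Adj x y) := by
  induction S, S.toFinite using Set.Finite.induction_on with
  | empty => exact absurd hS not_nontrivial_empty
  | @insert v T hv _ ih =>
    rcases T.subsingleton_or_nontrivial with hT | hT
    · obtain ⟨w, hw, hwv⟩ := hS.exists_ne v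
      have hw : w ∈ T := hw.resolve_left hwv
      obtain rfl : T = {w} := hT.eq_singleton_of_mem hw
      refine ⟨{v}, {w}, singleton_nonempty _, singleton_nonempty _, ?_, rfl, ?_⟩
      · simpa using hwv.symm
      · by_cases hvw : G.Adj v w
        · left; simpa using hvw
        · right; simpa using hvw
    · obtain ⟨X, Y, hX, hY, hd, rfl, hj | hs⟩ := ih hT
      -- A join is a disjoint union in the complement, which is again a cograph.
      · obtain ⟨X', Y', hX', hY', hd', hu, hc⟩ := h.compl.exists_partition_insert hX hY hd
          (fun h => hv (Or.inl h)) (fun h => hv (Or.inr h))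
          (fun x hx y hy h => h.2 (hj x hx y hy))
        refine ⟨X', Y', hX', hY', hd', hu, ?_⟩
        rcases hc with hc | hc
        · exact Or.inr fun x hx y hy => (hc x hx y hy).2
        · refine Or.inl fun x hx y hy => ?_
          by_contra hxy
          exact hc x hx y hy ⟨hd'.ne_of_mem hx hy, hxy⟩
      · exact h.exists_partition_insert hX hY hd
          (fun h => hv (Or.inl h)) (fun h => hv (Or.inr h)) hs

/-- Structural induction on the vertex sets of a cograph. -/
lemma IsCograph.induction [Finite V] (h : IsCograph G) {P : Set V → Prop}
    (subsingleton : ∀ S : Set V, S.Subsingleton → P S)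
    (join : ∀ X Y : Set V, X.Nonempty → Y.Nonempty → (∀ x ∈ X, ∀ y ∈ Y, G.Adj x y) →
      P X → P Y → P (X ∪ Y))
    (sum : ∀ X Y : Set V, (∀ x ∈ X, ∀ y ∈ Y, ¬ G.Adj x y) → P X → P Y → P (X ∪ Y))
    (S : Set V) : P S := by
  induction hn : S.ncard using Nat.strong_induction_on generalizing S with
  | _ n ih =>
    subst hn
    rcases S.subsingleton_or_nontrivial with hS | hS
    · exact subsingleton S hS
    · obtain ⟨X, Y, hX, hY, hd, rfl, hc⟩ := h.exists_partition S hS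
      have e := ncard_union_eq hd
      have hX' := hX.ncard_pos
      have hY' := hY.ncard_pos
      have PX := ih _ (by omega) X rfl
      have PY := ih _ (by omega) Y rfl
      rcases hc with hc | hc
      · exact join X Y hX hY hc PX PY
      · exact sum X Y hc PX PY

/-- `S` contains an induced `2K₂`. -/
def HasTwoEdges (G : SimpleGraph V) (S : Set V) : Prop :=
  ∃ a ∈ S, ∃ b ∈ S, ∃ c ∈ S, ∃ d ∈ S, G.Adj a b ∧ G.Adj c d ∧
    ¬ G.Adj a c ∧ ¬ G.Adj a d ∧ ¬ G.Adj b c ∧ ¬ G.Adj b d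

/-- `S` contains an induced cycle on four vertices. -/
def HasSquare (G : SimpleGraph V) (S : Set V) : Prop :=
  ∃ a ∈ S, ∃ b ∈ S, ∃ c ∈ S, ∃ d ∈ S, a ≠ b ∧ ¬ G.Adj a b ∧ c ≠ d ∧ ¬ G.Adj c d ∧
    G.Adj a c ∧ G.Adj a d ∧ G.Adj b c ∧ G.Adj b d

/-- `S` contains an induced path on three vertices. -/
def HasPath (G : SimpleGraph V) (S : Set V) : Prop :=
  ∃ p ∈ S, ∃ q ∈ S, ∃ r ∈ S, G.Adj p q ∧ G.Adj q r ∧ p ≠ r ∧ ¬ G.Adj p r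

lemma HasTwoEdges.mono (h : HasTwoEdges G S) (hST : S ⊆ T) : HasTwoEdges G T := by
  obtain ⟨a, ha, b, hb, c, hc, d, hd, h⟩ := h
  exact ⟨a, hST ha, b, hST hb, c, hST hc, d, hST hd, h⟩

lemma HasSquare.mono (h : HasSquare G S) (hST : S ⊆ T) : HasSquare G T := by
  obtain ⟨a, ha, b, hb, c, hc, d, hd, h⟩ := h
  exact ⟨a, hST ha, b, hST hb, c, hST hc, d, hST hd, h⟩

lemma hasPath_of_not_clusterOn [Finite V] (h : ¬ ∃ n, ClusterOn G S n) : HasPath G S :=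
  exists_induced_path_of_not_clusterOn h

lemma HasPath.not_clusterOn (h : HasPath G S) : ¬ ClusterOn G S n := by
  obtain ⟨a, ha, b, hb, c, hc, h1, h2, h3, h4⟩ := h
  exact not_clusterOn_of_path ha hb hc h1 h2 h3 h4 n

/-- With a single colour the cluster is a clique: `(1, 1)`-polar means split. -/
lemma monoOn_one_iff : MonoOn G S 1 ↔ ∃ A ⊆ S, (∀ a ∈ A, ∀ b ∈ A, ¬ G.Adj a b) ∧
    ∀ u ∈ S, u ∉ A → ∀ v ∈ S, v ∉ A → u ≠ v → G.Adj u v := by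
  constructor
  · rintro ⟨A, hA, h1, f, h2, h3⟩
    refine ⟨A, hA, h1, fun u hu huA v hv hvA huv => (h3 u ⟨hu, huA⟩ v ⟨hv, hvA⟩ huv).2 ?_⟩
    have := h2 u ⟨hu, huA⟩
    have := h2 v ⟨hv, hvA⟩
    omega
  · rintro ⟨A, hA, h1, h2⟩
    exact ⟨A, hA, h1, fun _ => 0, by simp, fun u hu v hv huv => by simp [h2 u hu.1 hu.2 v hv.1 hv.2 huv]⟩

lemma HasTwoEdges.not_monoOn (h : HasTwoEdges G S) : ¬ MonoOn G S 1 := by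
  obtain ⟨a, ha, b, hb, c, hc, d, hd, hab, hcd, hac, had, hbc, hbd⟩ := h
  rw [monoOn_one_iff]
  rintro ⟨A, -, h1, h2⟩
  have n1 : a ≠ c := by rintro rfl; exact had hcd
  have n2 : a ≠ d := by rintro rfl; exact hac hcd.symm
  have n3 : b ≠ c := by rintro rfl; exact hbd hcd
  have n4 : b ≠ d := by rintro rfl; exact hbc hcd.symm
  have hA1 : a ∉ A ∨ b ∉ A := by
    by_contra! h
    exact h1 a h.1 b h.2 hab
  have hA2 : c ∉ A ∨ d ∉ A := by
    by_contra! h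
    exact h1 c h.1 d h.2 hcd
  rcases hA1 with hA1 | hA1 <;> rcases hA2 with hA2 | hA2
  · exact hac (h2 a ha hA1 c hc hA2 n1)
  · exact had (h2 a ha hA1 d hd hA2 n2)
  · exact hbc (h2 b hb hA1 c hc hA2 n3)
  · exact hbd (h2 b hb hA1 d hd hA2 n4)

lemma HasSquare.not_monoOn (h : HasSquare G S) : ¬ MonoOn G S 1 := by
  obtain ⟨a, ha, b, hb, c, hc, d, hd, hne, hab, hne', hcd, hac, had, hbc, hbd⟩ := h
  rw [monoOn_one_iff]
  rintro ⟨A, -, h1, h2⟩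
  have hA1 : a ∈ A ∨ b ∈ A := by
    by_contra! h
    exact hab (h2 a ha h.1 b hb h.2 hne)
  have hA2 : c ∈ A ∨ d ∈ A := by
    by_contra! h
    exact hcd (h2 c hc h.1 d hd h.2 hne')
  rcases hA1 with hA1 | hA1 <;> rcases hA2 with hA2 | hA2
  · exact h1 a hA1 c hA2 hac
  · exact h1 a hA1 d hA2 had
  · exact h1 b hA1 c hA2 hbc
  · exact h1 b hA1 d hA2 hbd

/-- A join with a clique is split if the other side is. -/
lemma monoOn_one_join (hXY : ∀ x ∈ X, ∀ y ∈ Y, G.Adj x y)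
    (hX : ∀ x ∈ X, ∀ y ∈ X, x ≠ y → G.Adj x y) (hY : MonoOn G Y 1) : MonoOn G (X ∪ Y) 1 := by
  rw [monoOn_one_iff] at *
  obtain ⟨A, hA, h1, h2⟩ := hY
  refine ⟨A, hA.trans subset_union_right, h1, ?_⟩
  rintro u (hu | hu) huA v (hv | hv) hvA huv
  · exact hX u hu v hv huv
  · exact hXY u hu v hv
  · exact (hXY v hv u hu).symm
  · exact h2 u hu huA v hv hvA huv

/-- A disjoint union with an edgeless graph is split if the other side is. -/
lemma monoOn_one_sum (hXY : ∀ x ∈ X, ∀ y ∈ Y, ¬ G.Adj x y)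
    (hX : ∀ x ∈ X, ∀ y ∈ X, ¬ G.Adj x y) (hY : MonoOn G Y 1) : MonoOn G (X ∪ Y) 1 := by
  rw [monoOn_one_iff] at *
  obtain ⟨A, hA, h1, h2⟩ := hY
  refine ⟨X ∪ A, union_subset_union_right _ hA, ?_, ?_⟩
  · rintro u (hu | hu) v (hv | hv)
    · exact hX u hu v hv
    · exact hXY u hu v (hA hv)
    · exact fun h => hXY v hv u (hA hu) h.symm
    · exact h1 u hu v hv
  · rintro u (hu | hu) huA v (hv | hv) hvA huv
    · exact absurd (Or.inl hu) huA
    · exact absurd (Or.inl hu) huA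
    · exact absurd (Or.inl hv) hvA
    · exact h2 u hu (fun h => huA (Or.inr h)) v hv (fun h => hvA (Or.inr h)) huv

/-- In a join of split parts, a nonadjacent pair on each side yields a `C₄`, and otherwise one side
is a clique. Dually, in a union an edge on each side yields `2K₂`, and otherwise one side is
edgeless. -/
lemma IsCograph.split_cases [Finite V] (h : IsCograph G) (S : Set V) :
    MonoOn G S 1 ∨ HasTwoEdges G S ∨ HasSquare G S := by
  refine h.induction (P := fun S => MonoOn G S 1 ∨ HasTwoEdges G S ∨ HasSquare G S) ?_ ?_ ?_ S
  · intro S hS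
    exact Or.inl (monoOn_one_iff.2 ⟨∅, empty_subset _, by simp,
      fun u hu _ v hv _ huv => absurd (hS hu hv) huv⟩)
  · rintro X Y - - hXY (hX | hX | hX) (hY | hY | hY)
    · by_cases hXK : ∀ x ∈ X, ∀ y ∈ X, x ≠ y → G.Adj x y
      · exact Or.inl (monoOn_one_join hXY hXK hY)
      by_cases hYK : ∀ x ∈ Y, ∀ y ∈ Y, x ≠ y → G.Adj x y
      · rw [union_comm]
        exact Or.inl (monoOn_one_join (fun x hx y hy => (hXY y hy x hx).symm) hYK hX)
      push Not at hXK hYK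
      obtain ⟨a, ha, b, hb, hab, hab'⟩ := hXK
      obtain ⟨c, hc, d, hd, hcd, hcd'⟩ := hYK
      exact Or.inr (Or.inr ⟨a, Or.inl ha, b, Or.inl hb, c, Or.inr hc, d, Or.inr hd, hab, hab',
        hcd, hcd', hXY a ha c hc, hXY a ha d hd, hXY b hb c hc, hXY b hb d hd⟩)
    all_goals first
      | exact Or.inr (Or.inl (hX.mono subset_union_left))
      | exact Or.inr (Or.inr (hX.mono subset_union_left))
      | exact Or.inr (Or.inl (hY.mono subset_union_right))
      | exact Or.inr (Or.inr (hY.mono subset_union_right))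
  · rintro X Y hXY (hX | hX | hX) (hY | hY | hY)
    · by_cases hXK : ∀ x ∈ X, ∀ y ∈ X, ¬ G.Adj x y
      · exact Or.inl (monoOn_one_sum hXY hXK hY)
      by_cases hYK : ∀ x ∈ Y, ∀ y ∈ Y, ¬ G.Adj x y
      · rw [union_comm]
        exact Or.inl (monoOn_one_sum (fun x hx y hy h => hXY y hy x hx h.symm) hYK hX)
      push Not at hXK hYK
      obtain ⟨a, ha, b, hb, hab⟩ := hXK
      obtain ⟨c, hc, d, hd, hcd⟩ := hYK
      exact Or.inr (Or.inl ⟨a, Or.inl ha, b, Or.inl hb, c, Or.inr hc, d, Or.inr hd, hab, hcd,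
        hXY a ha c hc, hXY a ha d hd, hXY b hb c hc, hXY b hb d hd⟩)
    all_goals first
      | exact Or.inr (Or.inl (hX.mono subset_union_left))
      | exact Or.inr (Or.inr (hX.mono subset_union_left))
      | exact Or.inr (Or.inl (hY.mono subset_union_right))
      | exact Or.inr (Or.inr (hY.mono subset_union_right))

/-- `S` contains an induced disjoint union of `P₃` and `K₂`. -/
def HasPathEdge (G : SimpleGraph V) (S : Set V) : Prop :=
  ∃ p ∈ S, ∃ q ∈ S, ∃ r ∈ S, ∃ c ∈ S, ∃ d ∈ S, G.Adj p q ∧ G.Adj q r ∧ p ≠ r ∧ ¬ G.Adj p r ∧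
    G.Adj c d ∧ ∀ x ∈ ({p, q, r} : Set V), ¬ G.Adj x c ∧ ¬ G.Adj x d

/-- `S` contains an induced join of `K₁` and `2K₂`. -/
def HasButterfly (G : SimpleGraph V) (S : Set V) : Prop :=
  ∃ u ∈ S, ∃ a ∈ S, ∃ b ∈ S, ∃ c ∈ S, ∃ d ∈ S, G.Adj a b ∧ G.Adj c d ∧
    ¬ G.Adj a c ∧ ¬ G.Adj a d ∧ ¬ G.Adj b c ∧ ¬ G.Adj b d ∧
    ∀ x ∈ ({a, b, c, d} : Set V), G.Adj u x

lemma HasPathEdge.mono (h : HasPathEdge G S) (hST : S ⊆ T) : HasPathEdge G T := by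
  obtain ⟨p, hp, q, hq, r, hr, c, hc, d, hd, h⟩ := h
  exact ⟨p, hST hp, q, hST hq, r, hST hr, c, hST hc, d, hST hd, h⟩

lemma HasButterfly.mono (h : HasButterfly G S) (hST : S ⊆ T) : HasButterfly G T := by
  obtain ⟨p, hp, q, hq, r, hr, c, hc, d, hd, h⟩ := h
  exact ⟨p, hST hp, q, hST hq, r, hST hr, c, hST hc, d, hST hd, h⟩

/-- A cograph with an induced `2K₂` and an induced `P₃` contains the disjoint union of `P₃` and
`K₂` or the join of `K₁` and `2K₂`. -/
lemma IsCograph.hasPathEdge_or_hasButterfly [Finite V] (h : IsCograph G) (S : Set V)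
    (h2 : HasTwoEdges G S) (h3 : HasPath G S) : HasPathEdge G S ∨ HasButterfly G S := by
  revert h2 h3
  refine h.induction (P := fun S => HasTwoEdges G S → HasPath G S →
    HasPathEdge G S ∨ HasButterfly G S) ?_ ?_ ?_ S
  · rintro S hS ⟨a, ha, b, hb, -, -, -, -, hab, -⟩
    exact absurd (hS ha hb) hab.ne
  -- The nonadjacencies of a `2K₂` keep it inside one side of a join; any vertex of the other side
  -- is then a hub.
  · have side : ∀ {X Y : Set V} {a b c d : V}, (∀ x ∈ X, ∀ y ∈ Y, G.Adj x y) → Y.Nonempty →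
        a ∈ X → b ∈ X ∪ Y → c ∈ X ∪ Y → d ∈ X ∪ Y → ¬ G.Adj a c → ¬ G.Adj a d → ¬ G.Adj b c →
        ∃ u ∈ Y, ∀ x ∈ ({a, b, c, d} : Set V), G.Adj u x := by
      rintro X Y a b c d hXY ⟨u, hu⟩ ha hb hc hd hac had hbc
      have hc : c ∈ X := hc.resolve_right fun h => hac (hXY a ha c h)
      have hd : d ∈ X := hd.resolve_right fun h => had (hXY a ha d h)
      have hb : b ∈ X := hb.resolve_right fun h => hbc (hXY c hc b h).symm
      refine ⟨u, hu, ?_⟩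
      rintro x (rfl | rfl | rfl | rfl)
      · exact (hXY _ ha u hu).symm
      · exact (hXY _ hb u hu).symm
      · exact (hXY _ hc u hu).symm
      · exact (hXY _ hd u hu).symm
    rintro X Y hXne hYne hXY - - ⟨a, ha, b, hb, c, hc, d, hd, hab, hcd, hac, had, hbc, hbd⟩ -
    right
    rcases ha with ha' | ha'
    · obtain ⟨u, hu, hu'⟩ := side hXY hYne ha' hb hc hd hac had hbc
      exact ⟨u, Or.inr hu, a, Or.inl ha', b, hb, c, hc, d, hd, hab, hcd, hac, had, hbc, hbd, hu'⟩
    · rw [union_comm] at hb hc hd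
      obtain ⟨u, hu, hu'⟩ := side (fun x hx y hy => (hXY y hy x hx).symm) hXne ha' hb hc hd
        hac had hbc
      rw [union_comm] at hb hc hd
      exact ⟨u, Or.inl hu, a, Or.inr ha', b, hb, c, hc, d, hd, hab, hcd, hac, had, hbc, hbd, hu'⟩
  · have side : ∀ {X Y : Set V}, (∀ x ∈ X, ∀ y ∈ Y, ¬ G.Adj x y) → ∀ {p q r : V}, p ∈ X →
        q ∈ X ∪ Y → r ∈ X ∪ Y → G.Adj p q → G.Adj q r → q ∈ X ∧ r ∈ X := by
      intro X Y hXY p q r hp hq hr hpq hqr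
      have hq : q ∈ X := hq.resolve_right fun h => hXY p hp q h hpq
      exact ⟨hq, hr.resolve_right fun h => hXY q hq r h hqr⟩
    have main : ∀ {X Y : Set V}, (∀ x ∈ X, ∀ y ∈ Y, ¬ G.Adj x y) → ∀ {p q r : V}, p ∈ X →
        q ∈ X → r ∈ X → G.Adj p q → G.Adj q r → p ≠ r → ¬ G.Adj p r →
        HasTwoEdges G (X ∪ Y) → HasTwoEdges G X ∨
        HasPathEdge G (X ∪ Y) := by
      intro X Y hXY p q r hp hq hr hpq hqr hne hpr h2
      -- An edge on the side away from the path completes `P3 + K₂`; if there is none, both edges of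
      -- the `2K₂` lie on the side of the path.
      by_cases hY : ∃ c ∈ Y, ∃ d ∈ Y, G.Adj c d
      · obtain ⟨c, hc, d, hd, hcd⟩ := hY
        refine Or.inr ⟨p, Or.inl hp, q, Or.inl hq, r, Or.inl hr, c, Or.inr hc, d, Or.inr hd,
          hpq, hqr, hne, hpr, hcd, ?_⟩
        rintro x (rfl | rfl | rfl)
        · exact ⟨hXY _ hp c hc, hXY _ hp d hd⟩
        · exact ⟨hXY _ hq c hc, hXY _ hq d hd⟩
        · exact ⟨hXY _ hr c hc, hXY _ hr d hd⟩
      · left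
        have edge : ∀ {a b : V}, a ∈ X ∪ Y → b ∈ X ∪ Y → G.Adj a b → a ∈ X ∧ b ∈ X := by
          rintro a b (ha | ha) (hb | hb) hab
          · exact ⟨ha, hb⟩
          · exact absurd hab (hXY a ha b hb)
          · exact absurd hab.symm (hXY b hb a ha)
          · exact absurd ⟨a, ha, b, hb, hab⟩ hY
        obtain ⟨a, ha, b, hb, c, hc, d, hd, hab, hcd, hh⟩ := h2
        exact ⟨a, (edge ha hb hab).1, b, (edge ha hb hab).2, c, (edge hc hd hcd).1, d,
          (edge hc hd hcd).2, hab, hcd, hh⟩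
    rintro X Y hXY hX hY h2 ⟨p, hp, q, hq, r, hr, hpq, hqr, hne, hpr⟩
    rcases hp with hp | hp
    · obtain ⟨hq, hr⟩ := side hXY hp hq hr hpq hqr
      rcases main hXY hp hq hr hpq hqr hne hpr h2 with h | h
      · rcases hX h ⟨p, hp, q, hq, r, hr, hpq, hqr, hne, hpr⟩ with h | h
        · exact Or.inl (h.mono subset_union_left)
        · exact Or.inr (h.mono subset_union_left)
      · exact Or.inl h
    · have hYX : ∀ x ∈ Y, ∀ y ∈ X, ¬ G.Adj x y := fun x hx y hy h => hXY y hy x hx h.symm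
      rw [union_comm] at hq hr h2 ⊢
      obtain ⟨hq, hr⟩ := side hYX hp hq hr hpq hqr
      rcases main hYX hp hq hr hpq hqr hne hpr h2 with h | h
      · rcases hY h ⟨p, hp, q, hq, r, hr, hpq, hqr, hne, hpr⟩ with h | h
        · exact Or.inl (h.mono subset_union_left)
        · exact Or.inr (h.mono subset_union_left)
      · exact Or.inl h

end Decomposition

/-! ### The four minimal non-monopolar cographs, checked by computation -/

/-- The graph on `Fin n` with the listed edges. -/
def ofEdges (n : ℕ) (l : List (Fin n × Fin n)) : SimpleGraph (Fin n) where
  Adj i j := i ≠ j ∧ ((i, j) ∈ l ∨ (j, i) ∈ l)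
  symm := ⟨fun _ _ h => ⟨h.1.symm, h.2.symm⟩⟩
  loopless := ⟨fun _ h => h.1 rfl⟩

instance (n : ℕ) (l : List (Fin n × Fin n)) : DecidableRel (ofEdges n l).Adj :=
  fun i j => inferInstanceAs (Decidable (i ≠ j ∧ ((i, j) ∈ l ∨ (j, i) ∈ l)))

/-- The wheel `K₁ ⊕ C₄`. -/
abbrev wheel : SimpleGraph (Fin 5) :=
  ofEdges 5 [(0, 1), (0, 2), (0, 3), (0, 4), (1, 3), (1, 4), (2, 3), (2, 4)]

/-- The join of `K₁` and `P₃ + K₂`. -/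
abbrev conePathEdge : SimpleGraph (Fin 6) :=
  ofEdges 6 [(0, 1), (0, 2), (0, 3), (0, 4), (0, 5), (1, 2), (2, 3), (4, 5)]

/-- The join of `K₂` and `2K₂`. -/
abbrev edgeJoinTwoEdges : SimpleGraph (Fin 6) :=
  ofEdges 6 [(0, 1), (0, 2), (0, 3), (0, 4), (0, 5), (1, 2), (1, 3), (1, 4), (1, 5), (2, 3), (4, 5)]

/-- The join of two copies of `K₁ + K₂`. -/
abbrev joinVertexEdge : SimpleGraph (Fin 6) :=
  ofEdges 6 [(1, 2), (4, 5), (0, 3), (0, 4), (0, 5), (1, 3), (1, 4), (1, 5), (2, 3), (2, 4), (2, 5)]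

section Fin

variable {N n : ℕ} {F : SimpleGraph (Fin N)}

/-- A decidable certificate: for each deleted vertex `v`, an independent set `A v` and a colouring
`f v` of what remains. -/
lemma monoOn_compl_of_finset (A : Fin N → Finset (Fin N)) (f : Fin N → Fin N → ℕ)
    (h1 : ∀ v, v ∉ A v) (h2 : ∀ v, ∀ a ∈ A v, ∀ b ∈ A v, ¬ F.Adj a b)
    (h3 : ∀ v u, f v u < n)
    (h4 : ∀ v a b, a ∉ A v → b ∉ A v → a ≠ v → b ≠ v → a ≠ b → (F.Adj a b ↔ f v a = f v b))
    (v : Fin N) : MonoOn F {v}ᶜ n := by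
  refine ⟨A v, ?_, fun a ha b hb => h2 v a ha b hb, f v, fun u _ => h3 v u,
    fun a ha b hb hab => h4 v a b ha.2 hb.2 ha.1 hb.1 hab⟩
  rintro x hx rfl
  exact h1 x hx

lemma polarOn_one_of_finset (A : Finset (Fin N))
    (h1 : ∀ a ∈ A, ∀ b ∈ A, ∀ c ∈ A, ¬ F.Adj a b → ¬ F.Adj b c → ¬ F.Adj a c)
    (h2 : ∀ a b, a ∉ A → b ∉ A → a ≠ b → F.Adj a b) : PolarOn F univ 1 := by
  refine ⟨A, subset_univ _, h1, fun _ => 0, by simp, fun a ha b hb hab => ?_⟩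
  simp [h2 a b ha.2 hb.2 hab]

/-- An induced `P3` outside every independent set excludes all numbers of colours by one finite
check. -/
lemma not_monoOn_univ_of_finset
    (h : ∀ A : Finset (Fin N), (∀ a ∈ A, ∀ b ∈ A, ¬ F.Adj a b) →
      ∃ p q r, p ∉ A ∧ q ∉ A ∧ r ∉ A ∧ F.Adj p q ∧ F.Adj q r ∧ p ≠ r ∧ ¬ F.Adj p r) :
    ¬ MonoOn F univ n := by
  classical
  rintro ⟨A, -, h1, h2⟩
  obtain ⟨p, q, r, hp, hq, hr, hpq, hqr, hne, hpr⟩ := h A.toFinset (by simpa using h1)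
  simp only [mem_toFinset] at hp hq hr
  exact not_clusterOn_of_path (S := univ \ A) ⟨trivial, hp⟩ ⟨trivial, hq⟩ ⟨trivial, hr⟩ hpq hqr
    hne hpr n h2

end Fin

lemma not_monoOn_wheel {n : ℕ} : ¬ MonoOn wheel univ n := by
  apply not_monoOn_univ_of_finset
  decide

lemma not_monoOn_conePathEdge {n : ℕ} : ¬ MonoOn conePathEdge univ n := by
  apply not_monoOn_univ_of_finset
  decide

lemma not_monoOn_edgeJoinTwoEdges {n : ℕ} : ¬ MonoOn edgeJoinTwoEdges univ n := by
  apply not_monoOn_univ_of_finset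
  decide

lemma not_monoOn_joinVertexEdge {n : ℕ} : ¬ MonoOn joinVertexEdge univ n := by
  apply not_monoOn_univ_of_finset
  decide

lemma monoOn_compl_wheel (v : Fin 5) : MonoOn wheel {v}ᶜ 2 := by
  refine monoOn_compl_of_finset ![{1, 2}, {3, 4}, {3, 4}, {1, 2}, {1, 2}]
    (fun v u => if v = 0 ∧ u = 4 then 1 else 0) ?_ ?_ ?_ ?_ v <;> decide

lemma monoOn_compl_conePathEdge (v : Fin 6) : MonoOn conePathEdge {v}ᶜ 2 := by
  refine monoOn_compl_of_finset ![{1, 3}, {0}, {1, 3, 4}, {0}, {1, 3, 5}, {1, 3, 4}]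
    (fun v u => if (v = 0 ∨ v = 1 ∨ v = 3) ∧ 4 ≤ u then 1 else 0) ?_ ?_ ?_ ?_ v <;> decide

lemma monoOn_compl_edgeJoinTwoEdges (v : Fin 6) : MonoOn edgeJoinTwoEdges {v}ᶜ 2 := by
  refine monoOn_compl_of_finset ![{1}, {0}, {3, 4}, {2, 4}, {2, 5}, {2, 4}]
    (fun v u => if v ≤ 1 ∧ 4 ≤ u then 1 else 0) ?_ ?_ ?_ ?_ v <;> decide

lemma monoOn_compl_joinVertexEdge (v : Fin 6) : MonoOn joinVertexEdge {v}ᶜ 2 := by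
  refine monoOn_compl_of_finset ![{3, 4}, {0, 2}, {0, 1}, {0, 1}, {3, 5}, {3, 4}]
    (fun v u => if ((v = 1 ∨ v = 2) ∧ 4 ≤ u) ∨ (4 ≤ v ∧ (u = 1 ∨ u = 2)) then 1 else 0)
    ?_ ?_ ?_ ?_ v <;> decide

lemma polarOn_wheel : PolarOn wheel univ 1 := by
  refine polarOn_one_of_finset Finset.univ ?_ ?_ <;> decide

lemma polarOn_conePathEdge : PolarOn conePathEdge univ 1 := by
  refine polarOn_one_of_finset {0, 1, 2, 3} ?_ ?_ <;> decide

lemma polarOn_edgeJoinTwoEdges : PolarOn edgeJoinTwoEdges univ 1 := by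
  refine polarOn_one_of_finset {0, 1, 2, 3} ?_ ?_ <;> decide

lemma polarOn_joinVertexEdge : PolarOn joinVertexEdge univ 1 := by
  refine polarOn_one_of_finset {0, 3} ?_ ?_ <;> decide

/-! ### Finding one of the four graphs in a non-monopolar join -/

section List

variable {V : Type*} {G : SimpleGraph V} {X Y : Set V}

/-- `G` contains one of the four minimal cographs without a `(1, ∞)`-polar partition. -/
def HasNonmonopolar (G : SimpleGraph V) : Prop :=
  Nonempty (wheel ↪g G) ∨ Nonempty (conePathEdge ↪g G) ∨ Nonempty (edgeJoinTwoEdges ↪g G) ∨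
    Nonempty (joinVertexEdge ↪g G)

lemma hasNonmonopolar_of_square (hXY : ∀ x ∈ X, ∀ y ∈ Y, G.Adj x y) (hX : HasSquare G X)
    (hY : Y.Nonempty) : HasNonmonopolar G := by
  obtain ⟨a, ha, b, hb, c, hc, d, hd, hne, hab, hne', hcd, hac, had, hbc, hbd⟩ := hX
  obtain ⟨y, hy⟩ := hY
  have ya := (hXY a ha y hy).symm
  have yb := (hXY b hb y hy).symm
  have yc := (hXY c hc y hy).symm
  have yd := (hXY d hd y hy).symm
  refine Or.inl (nonempty_embedding_of_fin ![y, a, b, c, d] (fun i j hij => ?_) fun i j hij => ?_)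
  · fin_cases i <;> fin_cases j <;>
      simp [ya.ne, yb.ne, yc.ne, yd.ne, hac.ne, had.ne, hbc.ne, hbd.ne, hne, hne'] at hij ⊢
  · fin_cases i <;> fin_cases j <;>
      simp [ofEdges, ya, yb, yc, yd, hac, had, hbc, hbd, hab, hcd] at hij ⊢

lemma hasNonmonopolar_of_twoEdges_edge (hXY : ∀ x ∈ X, ∀ y ∈ Y, G.Adj x y)
    (hX : HasTwoEdges G X) {y z : V} (hy : y ∈ Y) (hz : z ∈ Y) (hyz : G.Adj y z) :
    HasNonmonopolar G := by
  obtain ⟨a, ha, b, hb, c, hc, d, hd, hab, hcd, hac, had, hbc, hbd⟩ := hX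
  have n1 : a ≠ c := by rintro rfl; exact had hcd
  have n2 : a ≠ d := by rintro rfl; exact hac hcd.symm
  have n3 : b ≠ c := by rintro rfl; exact hbd hcd
  have n4 : b ≠ d := by rintro rfl; exact hbc hcd.symm
  have ya := (hXY a ha y hy).symm
  have yb := (hXY b hb y hy).symm
  have yc := (hXY c hc y hy).symm
  have yd := (hXY d hd y hy).symm
  have za := (hXY a ha z hz).symm
  have zb := (hXY b hb z hz).symm
  have zc := (hXY c hc z hz).symm
  have zd := (hXY d hd z hz).symm
  refine Or.inr (Or.inr (Or.inl (nonempty_embedding_of_fin ![y, z, a, b, c, d]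
    (fun i j hij => ?_) fun i j hij => ?_)))
  · fin_cases i <;> fin_cases j <;>
      simp [ya.ne, yb.ne, yc.ne, yd.ne, za.ne, zb.ne, zc.ne, zd.ne, hyz.ne, hab.ne, hcd.ne,
        n1, n2, n3, n4] at hij ⊢
  · fin_cases i <;> fin_cases j <;>
      simp [ofEdges, ya, yb, yc, yd, za, zb, zc, zd, hyz, hab, hcd, hac, had, hbc, hbd] at hij ⊢

lemma hasNonmonopolar_of_pathEdge (hXY : ∀ x ∈ X, ∀ y ∈ Y, G.Adj x y) (hX : HasPathEdge G X)
    (hY : Y.Nonempty) : HasNonmonopolar G := by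
  obtain ⟨p, hp, q, hq, r, hr, c, hc, d, hd, hpq, hqr, hne, hpr, hcd, hx⟩ := hX
  obtain ⟨y, hy⟩ := hY
  have yp := (hXY p hp y hy).symm
  have yq := (hXY q hq y hy).symm
  have yr := (hXY r hr y hy).symm
  have yc := (hXY c hc y hy).symm
  have yd := (hXY d hd y hy).symm
  obtain ⟨hpc, hpd⟩ := hx p (by simp)
  obtain ⟨hqc, hqd⟩ := hx q (by simp)
  obtain ⟨hrc, hrd⟩ := hx r (by simp)
  have n1 : p ≠ c := by rintro rfl; exact hqc hpq.symm
  have n2 : p ≠ d := by rintro rfl; exact hqd hpq.symm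
  have n3 : q ≠ c := by rintro rfl; exact hpc hpq
  have n4 : q ≠ d := by rintro rfl; exact hpd hpq
  have n5 : r ≠ c := by rintro rfl; exact hqc hqr
  have n6 : r ≠ d := by rintro rfl; exact hqd hqr
  refine Or.inr (Or.inl (nonempty_embedding_of_fin ![y, p, q, r, c, d]
    (fun i j hij => ?_) fun i j hij => ?_))
  · fin_cases i <;> fin_cases j <;>
      simp [yp.ne, yq.ne, yr.ne, yc.ne, yd.ne, hpq.ne, hqr.ne, hcd.ne, hne,
        n1, n2, n3, n4, n5, n6] at hij ⊢
  · fin_cases i <;> fin_cases j <;>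
      simp [ofEdges, yp, yq, yr, yc, yd, hpq, hqr, hcd, hpr, hpc, hpd, hqc, hqd, hrc, hrd]
        at hij ⊢

/-- The hub and a vertex of the other side form an edge joined to the `2K₂`. -/
lemma hasNonmonopolar_of_butterfly (hXY : ∀ x ∈ X, ∀ y ∈ Y, G.Adj x y) (hX : HasButterfly G X)
    (hY : Y.Nonempty) : HasNonmonopolar G := by
  obtain ⟨u, hu, a, ha, b, hb, c, hc, d, hd, hab, hcd, hac, had, hbc, hbd, hx⟩ := hX
  obtain ⟨y, hy⟩ := hY
  refine hasNonmonopolar_of_twoEdges_edge (X := {a, b, c, d}) (Y := {u, y}) ?_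
    ⟨a, by simp, b, by simp, c, by simp, d, by simp, hab, hcd, hac, had, hbc, hbd⟩
    (y := u) (z := y) (by simp) (by simp) (hXY u hu y hy)
  rintro x hxm z (rfl | rfl)
  · exact (hx x hxm).symm
  · rcases hxm with rfl | rfl | rfl | rfl
    · exact hXY _ ha _ hy
    · exact hXY _ hb _ hy
    · exact hXY _ hc _ hy
    · exact hXY _ hd _ hy

lemma hasNonmonopolar_of_vertexEdge (hXY : ∀ x ∈ X, ∀ y ∈ Y, G.Adj x y)
    (hX : ∃ a ∈ X, ∃ b ∈ X, ∃ c ∈ X, G.Adj b c ∧ a ≠ b ∧ a ≠ c ∧ ¬ G.Adj a b ∧ ¬ G.Adj a c)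
    (hY : ∃ a ∈ Y, ∃ b ∈ Y, ∃ c ∈ Y, G.Adj b c ∧ a ≠ b ∧ a ≠ c ∧ ¬ G.Adj a b ∧ ¬ G.Adj a c) :
    HasNonmonopolar G := by
  obtain ⟨a, ha, b, hb, c, hc, hbc, n1, n2, hab, hac⟩ := hX
  obtain ⟨d, hd, e, he, f, hf, hef, n3, n4, hde, hdf⟩ := hY
  have ad := hXY a ha d hd
  have ae := hXY a ha e he
  have af := hXY a ha f hf
  have bd := hXY b hb d hd
  have be := hXY b hb e he
  have bf := hXY b hb f hf
  have cd := hXY c hc d hd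
  have ce := hXY c hc e he
  have cf := hXY c hc f hf
  refine Or.inr (Or.inr (Or.inr (nonempty_embedding_of_fin ![a, b, c, d, e, f]
    (fun i j hij => ?_) fun i j hij => ?_)))
  · fin_cases i <;> fin_cases j <;>
      simp [ad.ne, ae.ne, af.ne, bd.ne, be.ne, bf.ne, cd.ne, ce.ne, cf.ne, hbc.ne, hef.ne,
        n1, n2, n3, n4] at hij ⊢
  · fin_cases i <;> fin_cases j <;>
      simp [ofEdges, ad, ae, af, bd, be, bf, cd, ce, cf, hbc, hef, hab, hac, hde, hdf] at hij ⊢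

/-- A join with an independent side and a cluster side is monopolar. -/
lemma exists_monoOn_of_indep_cluster [Finite V] (hX : ∀ x ∈ X, ∀ y ∈ X, ¬ G.Adj x y)
    (hY : ¬ HasPath G Y) : ∃ n, MonoOn G (X ∪ Y) n := by
  have : ∃ n, ClusterOn G Y n := by
    by_contra h
    exact hY (hasPath_of_not_clusterOn h)
  obtain ⟨n, hn⟩ := this
  refine ⟨n, X, subset_union_left, hX, hn.mono ?_ le_rfl⟩
  rintro x ⟨hx | hx, hx'⟩
  · exact absurd hx hx'
  · exact hx

/-- A `P3`-free set is a cluster; if it is neither complete nor edgeless, it has an edge and a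
vertex in another clique. -/
lemma exists_vertexEdge (hK : ¬ ∀ x ∈ X, ∀ y ∈ X, x ≠ y → G.Adj x y)
    (hI : ¬ ∀ x ∈ X, ∀ y ∈ X, ¬ G.Adj x y) (hP : ¬ HasPath G X) :
    ∃ a ∈ X, ∃ b ∈ X, ∃ c ∈ X, G.Adj b c ∧ a ≠ b ∧ a ≠ c ∧ ¬ G.Adj a b ∧ ¬ G.Adj a c := by
  push Not at hK hI
  obtain ⟨x, hx, y, hy, hxy, hxy'⟩ := hK
  obtain ⟨b, hb, c, hc, hbc⟩ := hI
  have tr : ∀ p ∈ X, ∀ q ∈ X, ∀ r ∈ X, G.Adj p q → G.Adj q r → p ≠ r → G.Adj p r := by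
    intro p hp q hq r hr hpq hqr hne
    by_contra hpr
    exact hP ⟨p, hp, q, hq, r, hr, hpq, hqr, hne, hpr⟩
  by_contra hcon
  push Not at hcon
  have near : ∀ a ∈ X, a = b ∨ G.Adj a b := by
    intro a ha
    by_contra! h
    by_cases hac : a = c
    · subst hac; exact h.2 hbc.symm
    exact h.2 (tr a ha c hc b hb (hcon a ha b hb c hc hbc h.1 hac h.2) hbc.symm h.1)
  rcases near x hx with rfl | h1 <;> rcases near y hy with rfl | h2
  · exact hxy rfl
  · exact hxy' h2.symm
  · exact hxy' h1
  · exact hxy' (tr x hx b hb y hy h1 h2.symm hxy)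

/-- A join of two nonempty parts without a monopolar partition contains one of the four graphs. -/
lemma IsCograph.hasNonmonopolar_of_join [Finite V] (h : IsCograph G) (hX : X.Nonempty)
    (hY : Y.Nonempty) (hXY : ∀ x ∈ X, ∀ y ∈ Y, G.Adj x y) (hn : ¬ ∃ n, MonoOn G (X ∪ Y) n) :
    HasNonmonopolar G := by
  have hYX : ∀ x ∈ Y, ∀ y ∈ X, G.Adj x y := fun x hx y hy => (hXY y hy x hx).symm
  have hn' : ¬ ∃ n, MonoOn G (Y ∪ X) n := by rwa [union_comm]
  have big : ∀ {X Y : Set V}, Y.Nonempty → (∀ x ∈ X, ∀ y ∈ Y, G.Adj x y) →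
      (¬ ∃ n, MonoOn G (Y ∪ X) n) → ¬ MonoOn G X 1 → HasNonmonopolar G := by
    intro X Y hY hXY hn hX
    rcases (h.split_cases X).resolve_left hX with h2 | h2
    · by_cases hI : ∀ x ∈ Y, ∀ y ∈ Y, ¬ G.Adj x y
      · by_cases hP : HasPath G X
        · rcases h.hasPathEdge_or_hasButterfly X h2 hP with h3 | h3
          · exact hasNonmonopolar_of_pathEdge hXY h3 hY
          · exact hasNonmonopolar_of_butterfly hXY h3 hY
        · exact absurd (exists_monoOn_of_indep_cluster hI hP) hn
      · push Not at hI
        obtain ⟨y, hy, z, hz, hyz⟩ := hI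
        exact hasNonmonopolar_of_twoEdges_edge hXY h2 hy hz hyz
    · exact hasNonmonopolar_of_square hXY h2 hY
  by_cases sX : MonoOn G X 1
  swap
  · exact big hY hXY hn' sX
  by_cases sY : MonoOn G Y 1
  swap
  · exact big hX hYX hn sY
  have kX : ¬ ∀ x ∈ X, ∀ y ∈ X, x ≠ y → G.Adj x y :=
    fun hc => hn ⟨1, monoOn_one_join hXY hc sY⟩
  have kY : ¬ ∀ x ∈ Y, ∀ y ∈ Y, x ≠ y → G.Adj x y :=
    fun hc => hn' ⟨1, monoOn_one_join hYX hc sX⟩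
  -- The ends of an induced path in `X` and a nonadjacent pair in `Y` form a `C₄`, with the middle
  -- of the path as hub of a wheel.
  have path : ∀ {X Y : Set V}, (∀ x ∈ X, ∀ y ∈ Y, G.Adj x y) →
      (¬ ∀ x ∈ Y, ∀ y ∈ Y, x ≠ y → G.Adj x y) → HasPath G X → HasNonmonopolar G := by
    rintro X Y hXY hK ⟨p, hp, q, hq, r, hr, hpq, hqr, hne, hpr⟩
    push Not at hK
    obtain ⟨y, hy, z, hz, hyz, hyz'⟩ := hK
    refine hasNonmonopolar_of_square (X := {p, r, y, z}) (Y := {q}) ?_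
      ⟨p, by simp, r, by simp, y, by simp, z, by simp, hne, hpr, hyz, hyz', hXY p hp y hy,
        hXY p hp z hz, hXY r hr y hy, hXY r hr z hz⟩ (singleton_nonempty q)
    rintro x (rfl | rfl | rfl | rfl) _ rfl
    · exact hpq
    · exact hqr.symm
    · exact (hXY _ hq _ hy).symm
    · exact (hXY _ hq _ hz).symm
  by_cases pX : HasPath G X
  · exact path hXY kY pX
  by_cases pY : HasPath G Y
  · exact path hYX kX pY
  -- Both sides are now clusters that are not complete. An edgeless side would make the join
  -- monopolar.
  refine hasNonmonopolar_of_vertexEdge hXY (exists_vertexEdge kX (fun hI => ?_) pX)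
    (exists_vertexEdge kY (fun hI => ?_) pY)
  · exact hn (exists_monoOn_of_indep_cluster hI pY)
  · exact hn' (exists_monoOn_of_indep_cluster hI pX)

lemma exists_monoOn_sum [Finite V] (hXY : ∀ x ∈ X, ∀ y ∈ Y, ¬ G.Adj x y)
    (hX : ∃ n, MonoOn G X n) (hY : ∃ n, MonoOn G Y n) : ∃ n, MonoOn G (X ∪ Y) n := by
  obtain ⟨m, A, hA, a1, a2⟩ := hX
  obtain ⟨n, B, hB, b1, b2⟩ := hY
  have : ∃ n, ClusterOn G ((X ∪ Y) \ (A ∪ B)) n := by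
    refine exists_clusterOn ?_
    rintro a ⟨ha | ha, ha'⟩ b ⟨hb | hb, hb'⟩ c ⟨hc | hc, hc'⟩ hab hbc hac
    · exact a2.adj_trans ⟨ha, fun h => ha' (Or.inl h)⟩ ⟨hb, fun h => hb' (Or.inl h)⟩
        ⟨hc, fun h => hc' (Or.inl h)⟩ hab hbc hac
    · exact absurd hbc (hXY b hb c hc)
    · exact absurd hab (hXY a ha b hb)
    · exact absurd hab (hXY a ha b hb)
    · exact absurd hab.symm (hXY b hb a ha)
    · exact absurd hab.symm (hXY b hb a ha)
    · exact absurd hbc.symm (hXY c hc b hb)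
    · exact b2.adj_trans ⟨ha, fun h => ha' (Or.inr h)⟩ ⟨hb, fun h => hb' (Or.inr h)⟩
        ⟨hc, fun h => hc' (Or.inr h)⟩ hab hbc hac
  obtain ⟨k, hk⟩ := this
  refine ⟨k, A ∪ B, union_subset_union hA hB, ?_, hk⟩
  rintro a (ha | ha) b (hb | hb)
  · exact a1 a ha b hb
  · exact hXY a (hA ha) b (hB hb)
  · exact fun h => hXY b (hA hb) a (hB ha) h.symm
  · exact b1 a ha b hb

end List

/-! ### Classification of the minimal `(1, ∞)`-polar obstructions -/

section Minimal

variable {V W : Type*} {G : SimpleGraph V}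

/-- A vertex missed by the embedding would leave the non-monopolar `F` inside a monopolar
vertex-deleted subgraph. -/
lemma nonempty_iso_of_embedding {F : SimpleGraph W} (hF : ∀ n, ¬ MonoOn F univ n)
    (hG : ∀ v, ∃ n, MonoOn G {v}ᶜ n) (e : F ↪g G) : Nonempty (F ≃g G) := by
  refine ⟨RelIso.ofSurjective e fun v => ?_⟩
  by_contra hv
  obtain ⟨n, hn⟩ := hG v
  refine hF n ((MonoOn.image_iff e).1 (hn.mono ?_ le_rfl))
  rintro _ ⟨w, -, rfl⟩ h
  exact hv ⟨w, h⟩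

/-- The minimal cographs without a `(1, ∞)`-polar partition. -/
lemma IsCographMinimalObstruction.nonempty_iso [Finite V]
    (h : IsCographMinimalObstruction 1 ⊤ G) :
    Nonempty (wheel ≃g G) ∨ Nonempty (conePathEdge ≃g G) ∨ Nonempty (edgeJoinTwoEdges ≃g G) ∨
      Nonempty (joinVertexEdge ≃g G) := by
  obtain ⟨hc, hn, hv⟩ := isCographMinimalObstruction_one_top_iff.1 h
  have hnt : (univ : Set V).Nontrivial := by
    by_contra hs
    rw [not_nontrivial_iff] at hs
    exact hn ⟨0, univ, subset_rfl, fun a ha b hb hab => hab.ne (hs ha hb),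
      by simpa using clusterOn_empty⟩
  obtain ⟨X, Y, ⟨x, hx⟩, ⟨y, hy⟩, hd, hu, hj | hs⟩ := hc.exists_partition univ hnt
  · rw [← hu] at hn
    rcases hc.hasNonmonopolar_of_join ⟨x, hx⟩ ⟨y, hy⟩ hj hn with ⟨⟨e⟩⟩ | ⟨⟨e⟩⟩ | ⟨⟨e⟩⟩ | ⟨⟨e⟩⟩
    · exact Or.inl (nonempty_iso_of_embedding (fun _ => not_monoOn_wheel) hv e)
    · exact Or.inr (Or.inl (nonempty_iso_of_embedding (fun _ => not_monoOn_conePathEdge) hv e))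
    · exact Or.inr (Or.inr (Or.inl
        (nonempty_iso_of_embedding (fun _ => not_monoOn_edgeJoinTwoEdges) hv e)))
    · exact Or.inr (Or.inr (Or.inr
        (nonempty_iso_of_embedding (fun _ => not_monoOn_joinVertexEdge) hv e)))
  · refine absurd ?_ hn
    rw [← hu]
    refine exists_monoOn_sum hs ?_ ?_
    · obtain ⟨n, h⟩ := hv y
      exact ⟨n, h.mono (fun z hz => hd.ne_of_mem hz hy) le_rfl⟩
    · obtain ⟨n, h⟩ := hv x
      exact ⟨n, h.mono (fun z hz => (hd.ne_of_mem hx hz).symm) le_rfl⟩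

lemma not_polarOn_zero {a b c : V} (hab : G.Adj a b) (hac : ¬ G.Adj a c) (hcb : ¬ G.Adj c b) :
    ¬ PolarOn G univ 0 := by
  rintro ⟨A, -, h1, f, h2, -⟩
  have key : ∀ x, x ∈ A := fun x => by
    by_contra hx
    exact absurd (h2 x ⟨trivial, hx⟩) (Nat.not_lt_zero _)
  exact h1 a (key a) c (key c) b (key b) hac hcb hab

lemma IsCographMinimalObstruction.polarOn_one [Finite V]
    (h : IsCographMinimalObstruction 1 ⊤ G) : PolarOn G univ 1 := by
  rcases h.nonempty_iso with ⟨⟨e⟩⟩ | ⟨⟨e⟩⟩ | ⟨⟨e⟩⟩ | ⟨⟨e⟩⟩ <;> rw [polarOn_univ_iso e]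
  · exact polarOn_wheel
  · exact polarOn_conePathEdge
  · exact polarOn_edgeJoinTwoEdges
  · exact polarOn_joinVertexEdge

lemma IsCographMinimalObstruction.monoOn_compl [Finite V]
    (h : IsCographMinimalObstruction 1 ⊤ G) (v : V) : MonoOn G {v}ᶜ 2 := by
  rcases h.nonempty_iso with ⟨⟨e⟩⟩ | ⟨⟨e⟩⟩ | ⟨⟨e⟩⟩ | ⟨⟨e⟩⟩ <;>
    rw [← e.apply_symm_apply v, monoOn_compl_iso e]
  · exact monoOn_compl_wheel _
  · exact monoOn_compl_conePathEdge _
  · exact monoOn_compl_edgeJoinTwoEdges _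
  · exact monoOn_compl_joinVertexEdge _

/-- Only the wheel is complete multipartite, and deleting its hub leaves a `C₄`, neither split nor a
cluster. This excludes `k = 2` from condition 4. -/
lemma IsCographMinimalObstruction.exists_square_of_polarOn_zero [Finite V]
    (h : IsCographMinimalObstruction 1 ⊤ G) (h0 : PolarOn G univ 0) :
    ∃ v, ¬ MonoOn G {v}ᶜ 1 ∧ ∀ n, ¬ ClusterOn G {v}ᶜ n := by
  rcases h.nonempty_iso with ⟨⟨e⟩⟩ | ⟨⟨e⟩⟩ | ⟨⟨e⟩⟩ | ⟨⟨e⟩⟩ <;> rw [polarOn_univ_iso e] at h0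
  · refine ⟨e 0, ?_, fun n => ?_⟩
    · rw [monoOn_compl_iso e]
      refine HasSquare.not_monoOn
        ⟨1, by simp, 2, by simp, 3, by simp, 4, by simp, ?_, ?_, ?_, ?_, ?_, ?_, ?_, ?_⟩ <;> decide
    · rw [clusterOn_compl_iso e]
      refine not_clusterOn_of_path (a := 1) (b := 3) (c := 2) ?_ ?_ ?_ ?_ ?_ ?_ ?_ n
      on_goal 4 => decide
      on_goal 4 => decide
      on_goal 5 => decide
      all_goals simp
  · exact absurd h0 (not_polarOn_zero (a := 1) (b := 2) (c := 4) (by decide) (by decide) (by decide))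
  · exact absurd h0 (not_polarOn_zero (a := 2) (b := 3) (c := 4) (by decide) (by decide) (by decide))
  · exact absurd h0 (not_polarOn_zero (a := 1) (b := 2) (c := 0) (by decide) (by decide) (by decide))

end Minimal

section Nonmonopolar

variable {V : Type*} {H : SimpleGraph V} {m : ℕ}

/-- The case of a residue that is not monopolar. -/
lemma isResidue_iff_of_not_monoOn [Finite V] (hn : ¬ ∃ n, MonoOn H univ n) :
    IsResidue m H ↔ 1 ≤ m ∧ IsCographMinimalObstruction 1 ⊤ H := by
  constructor
  · intro h
    have hmin : IsCographMinimalObstruction 1 ⊤ H := by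
      refine isCographMinimalObstruction_one_top_iff.2 ⟨h.isCograph, hn, fun v => ?_⟩
      rcases h.compl v with h | h
      · exact ⟨_, h⟩
      · exact ⟨_, h.monoOn⟩
    refine ⟨?_, hmin⟩
    by_contra hm
    obtain rfl : m = 0 := by omega
    have h0 := h.monoOn_or.resolve_left fun h => hn ⟨_, h⟩
    obtain ⟨v, h1, h2⟩ := hmin.exists_square_of_polarOn_zero h0
    rcases h.compl v with h | h
    · exact h1 h
    · exact h2 _ h
  · rintro ⟨hm, h⟩
    refine ⟨h.1, fun h => hn ⟨_, h⟩, fun h => hn ⟨_, h.monoOn⟩,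
      h.polarOn_one.mono subset_rfl (by omega), Or.inr (h.polarOn_one.mono subset_rfl hm),
      fun v => Or.inl ((h.monoOn_compl v).mono subset_rfl (by omega))⟩

end Nonmonopolar

/-! ### Restoring vertices to clusters; monopolar joins -/

section Cluster

variable {V : Type*} {G : SimpleGraph V} {B S X Y : Set V} {m n j : ℕ}

/-- A vertex of a cluster can be added without a new component if it has a neighbour. -/
lemma ClusterOn.add_of_adj (hB : ClusterOn G B m) {u x : V} (h : ClusterOn G (B \ {u}) n)
    (hu : u ∈ B) (hx : x ∈ B) (hxu : G.Adj x u) : ClusterOn G B n := by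
  classical
  obtain ⟨g, h1, h2⟩ := h
  have hx' : x ∈ B \ {u} := ⟨hx, hxu.ne⟩
  have key : ∀ b ∈ B, b ≠ u → (G.Adj u b ↔ g x = g b) := by
    intro b hb hbu
    by_cases hbx : b = x
    · subst hbx; simp [hxu.symm]
    · rw [← h2 x hx' b ⟨hb, hbu⟩ (Ne.symm hbx)]
      exact ⟨fun h => hB.adj_trans hx hu hb hxu h (Ne.symm hbx),
        fun h => hB.adj_trans hu hx hb hxu.symm h (Ne.symm hbu)⟩
  refine ⟨Function.update g u (g x), fun b hb => ?_, fun a ha b hb hab => ?_⟩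
  · by_cases hbu : b = u
    · subst hbu; simpa using h1 x hx'
    · simpa [hbu] using h1 b ⟨hb, hbu⟩
  · by_cases hau : a = u
    · subst hau
      simpa [Ne.symm hab] using key b hb (Ne.symm hab)
    · by_cases hbu : b = u
      · subst hbu
        simpa [hau, G.adj_comm, eq_comm] using key a ha hau
      · simpa [hau, hbu] using h2 a ⟨ha, hau⟩ b ⟨hb, hbu⟩ hab

/-- Adding a vertex to a cluster adds at most one component. -/
lemma ClusterOn.add_vertex (hB : ClusterOn G B m) {u : V} (h : ClusterOn G (B \ {u}) n) :
    ClusterOn G B (n + 1) := by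
  classical
  by_cases hu : u ∈ B
  swap
  · rw [sdiff_singleton_eq_self hu] at h
    exact h.mono subset_rfl (by omega)
  by_cases hx : ∃ x ∈ B, G.Adj x u
  · obtain ⟨x, hx, hxu⟩ := hx
    exact (hB.add_of_adj h hu hx hxu).mono subset_rfl (by omega)
  push Not at hx
  obtain ⟨g, h1, h2⟩ := h
  refine ⟨Function.update g u n, fun b hb => ?_, fun a ha b hb hab => ?_⟩
  · by_cases hbu : b = u
    · subst hbu; simp
    · have := h1 b ⟨hb, hbu⟩
      simp [hbu]; omega
  · by_cases hau : a = u
    · have hub : ¬ G.Adj u b := fun h => hx b hb h.symm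
      subst hau
      have := h1 b ⟨hb, Ne.symm hab⟩
      simp [Ne.symm hab, hub]; omega
    · by_cases hbu : b = u
      · subst hbu
        have := h1 a ⟨ha, hau⟩
        simp [hau, hx a ha]; omega
      · simpa [hau, hbu] using h2 a ⟨ha, hau⟩ b ⟨hb, hbu⟩ hab

lemma MonoOn.add_vertex (hS : ClusterOn G S m) {u : V} (h : MonoOn G (S \ {u}) n) :
    MonoOn G S (n + 1) := by
  obtain ⟨A, hA, h1, h2⟩ := h
  refine ⟨A, hA.trans sdiff_subset, h1, (hS.mono sdiff_subset le_rfl).add_vertex (u := u)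
    (h2.mono ?_ le_rfl)⟩
  exact fun x hx => ⟨⟨hx.1.1, hx.2⟩, hx.1.2⟩

/-- A vertex with two neighbours in a cluster does not matter. -/
lemma MonoOn.add_of_adj (hS : ClusterOn G S m) {u x y : V} (hu : u ∈ S) (hx : x ∈ S)
    (hy : y ∈ S) (hxu : G.Adj x u) (hyu : G.Adj y u) (hxy : x ≠ y) (h : MonoOn G (S \ {u}) n) :
    MonoOn G S n := by
  obtain ⟨A, hA, h1, h2⟩ := h
  have huA : u ∉ A := fun h => (hA h).2 rfl
  have key : ∃ z ∈ S \ A, G.Adj z u := by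
    -- The two neighbours of `u` are adjacent to each other, so the independent set `A` misses one
    -- of them.
    by_cases hxA : x ∈ A
    · refine ⟨y, ⟨hy, fun hyA => ?_⟩, hyu⟩
      exact h1 x hxA y hyA (hS.adj_trans hx hu hy hxu hyu.symm hxy)
    · exact ⟨x, ⟨hx, hxA⟩, hxu⟩
  obtain ⟨z, hz, hzu⟩ := key
  refine ⟨A, hA.trans sdiff_subset, h1, (hS.mono sdiff_subset le_rfl).add_of_adj
    (h2.mono ?_ le_rfl) ⟨hu, huA⟩ hz hzu⟩
  exact fun x hx => ⟨⟨hx.1.1, hx.2⟩, hx.1.2⟩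

lemma MonoOn.add_of_isolated {u : V} (hu : ∀ x ∈ S, ¬ G.Adj u x) (huS : u ∈ S)
    (h : MonoOn G (S \ {u}) n) : MonoOn G S n := by
  obtain ⟨A, hA, h1, h2⟩ := h
  have hAS := hA.trans sdiff_subset
  refine ⟨insert u A, insert_subset huS hAS, ?_, h2.mono ?_ le_rfl⟩
  · rintro a (rfl | ha) b (rfl | hb)
    · exact G.loopless.irrefl _
    · exact hu b (hAS hb)
    · exact fun h => hu a (hAS ha) h.symm
    · exact h1 a ha b hb
  · rintro x ⟨hx, hx'⟩
    exact ⟨⟨hx, fun h => hx' (Or.inl h)⟩, fun h => hx' (Or.inr h)⟩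

/-- A join that is a cluster is complete. -/
lemma ClusterOn.adj_of_join (h : ClusterOn G (X ∪ Y) n) (hX : X.Nonempty)
    (hY : Y.Nonempty) (hXY : ∀ x ∈ X, ∀ y ∈ Y, G.Adj x y) :
    ∀ u ∈ X ∪ Y, ∀ v ∈ X ∪ Y, u ≠ v → G.Adj u v := by
  obtain ⟨f, -, h2⟩ := h
  obtain ⟨x, hx⟩ := hX
  obtain ⟨y, hy⟩ := hY
  have e : ∀ x ∈ X, ∀ y ∈ Y, f x = f y := fun x hx y hy =>
    (h2 x (Or.inl hx) y (Or.inr hy) (hXY x hx y hy).ne).1 (hXY x hx y hy)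
  have e' : ∀ u ∈ X ∪ Y, f u = f y := by
    rintro u (hu | hu)
    · exact e u hu y hy
    · rw [← e x hx u hu, e x hx y hy]
  exact fun u hu v hv huv => (h2 u hu v hv huv).2 ((e' u hu).trans (e' v hv).symm)

lemma ClusterOn.monoOn_one_of_join (h : ClusterOn G (X ∪ Y) n) (hX : X.Nonempty)
    (hY : Y.Nonempty) (hXY : ∀ x ∈ X, ∀ y ∈ Y, G.Adj x y) : MonoOn G (X ∪ Y) 1 :=
  monoOn_one_iff.2 ⟨∅, empty_subset _, by simp, fun u hu _ v hv _ huv =>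
    h.adj_of_join hX hY hXY u hu v hv huv⟩

/-- A `(1, n)`-polar join is split, or the join of an independent set and a cluster. -/
lemma MonoOn.join_cases (h : MonoOn G (X ∪ Y) n) (hX : X.Nonempty) (hY : Y.Nonempty)
    (hXY : ∀ x ∈ X, ∀ y ∈ Y, G.Adj x y) : MonoOn G (X ∪ Y) 1 ∨
      ((∀ x ∈ X, ∀ y ∈ X, ¬ G.Adj x y) ∧ ClusterOn G Y n) ∨
      ((∀ x ∈ Y, ∀ y ∈ Y, ¬ G.Adj x y) ∧ ClusterOn G X n) := by
  obtain ⟨A, hA, h1, h2⟩ := h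
  have side : ∀ {X Y : Set V}, Y.Nonempty → (∀ x ∈ X, ∀ y ∈ Y, G.Adj x y) → A ⊆ X →
      ClusterOn G ((X ∪ Y) \ A) n → MonoOn G (X ∪ Y) 1 ∨
      ((∀ x ∈ X, ∀ y ∈ X, ¬ G.Adj x y) ∧ ClusterOn G Y n) := by
    intro X Y hY hXY hAX h2
    have hYA : ∀ y ∈ Y, y ∉ A := fun y hy hyA => (hXY y (hAX hyA) y hy).ne rfl
    -- If part of `X` stays outside `A`, the remaining cluster is a join, hence a clique, and the
    -- set is split.
    by_cases hXA : X ⊆ A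
    · right
      obtain rfl := hAX.antisymm hXA
      exact ⟨h1, h2.mono (fun y hy => ⟨Or.inr hy, hYA y hy⟩) le_rfl⟩
    · left
      obtain ⟨x, hx, hxA⟩ := not_subset.1 hXA
      have e : (X ∪ Y) \ A = X \ A ∪ Y := by
        ext z
        simp only [mem_sdiff, mem_union]
        have := hYA z
        tauto
      rw [e] at h2
      have h4 := h2.adj_of_join ⟨x, hx, hxA⟩ hY fun x hx y hy => hXY x hx.1 y hy
      rw [← e] at h4
      exact monoOn_one_iff.2 ⟨A, hAX.trans subset_union_left, h1,
        fun u hu huA v hv hvA huv => h4 u ⟨hu, huA⟩ v ⟨hv, hvA⟩ huv⟩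
  by_cases hAX : ∃ a ∈ A, a ∈ X
  · obtain ⟨a, ha, haX⟩ := hAX
    have hAX : A ⊆ X := fun b hb => (hA hb).resolve_right fun hbY => h1 a ha b hb (hXY a haX b hbY)
    rcases side hY hXY hAX h2 with h | h
    · exact Or.inl h
    · exact Or.inr (Or.inl h)
  · have hAY : A ⊆ Y := fun b hb => (hA hb).resolve_left fun hbX => hAX ⟨b, hb, hbX⟩
    rw [union_comm] at h2 ⊢
    rcases side hX (fun x hx y hy => (hXY y hy x hx).symm) hAY h2 with h | h
    · exact Or.inl h
    · exact Or.inr (Or.inr h)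

end Cluster

/-! ### Connected monopolar cographs -/

section Connected

variable {V : Type*} {G : SimpleGraph V} {m n j : ℕ}

/-- A connected cograph with at least two vertices is a join. -/
lemma IsCograph.exists_join [Finite V] (hc : IsCograph G) (hG : G.Connected)
    (hn : (univ : Set V).Nontrivial) :
    ∃ X : Set V, X.Nonempty ∧ Xᶜ.Nonempty ∧ ∀ x ∈ X, ∀ y ∈ Xᶜ, G.Adj x y := by
  obtain ⟨X, Y, hX, hY, hd, hu, hc⟩ := hc.exists_partition univ hn
  obtain rfl : Y = Xᶜ := (IsCompl.compl_eq ⟨hd, codisjoint_iff.2 hu⟩).symm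
  refine ⟨X, hX, hY, hc.resolve_right fun hs => ?_⟩
  obtain ⟨x, hx⟩ := hX
  obtain ⟨y, hy⟩ := hY
  obtain ⟨p⟩ := hG.preconnected x y
  obtain ⟨d, -, h1, h2⟩ := p.exists_boundary_dart X hx hy
  exact hs _ h1 _ h2 d.adj

lemma nontrivial_of_not_monoOn (h : ¬ MonoOn G univ n) : (univ : Set V).Nontrivial := by
  by_contra hs
  rw [not_nontrivial_iff] at hs
  exact h ⟨univ, subset_rfl, fun a ha b hb hab => hab.ne (hs ha hb), by simpa using clusterOn_empty⟩

/-- A connected monopolar cograph that is not split is the join of an independent set and a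
cluster. -/
lemma IsCograph.exists_indep_join_cluster [Finite V] (hc : IsCograph G) (hG : G.Connected)
    (h1 : ¬ MonoOn G univ 1) (hn : MonoOn G univ n) :
    ∃ I : Set V, I.Nonempty ∧ Iᶜ.Nonempty ∧ (∀ x ∈ I, ∀ y ∈ I, ¬ G.Adj x y) ∧
      (∀ x ∈ I, ∀ y ∈ Iᶜ, G.Adj x y) ∧ ClusterOn G Iᶜ n := by
  obtain ⟨X, hX, hY, hXY⟩ := hc.exists_join hG (nontrivial_of_not_monoOn h1)
  rw [← union_compl_self X] at h1 hn
  rcases hn.join_cases hX hY hXY with h | ⟨h, h'⟩ | ⟨h, h'⟩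
  · exact absurd h h1
  · exact ⟨X, hX, hY, h, hXY, h'⟩
  · refine ⟨Xᶜ, hY, by rwa [compl_compl], h, ?_, by rwa [compl_compl]⟩
    rw [compl_compl]
    exact fun x hx y hy => (hXY y hy x hx).symm

lemma monoOn_of_indep_cluster {I : Set V} (h : ∀ x ∈ I, ∀ y ∈ I, ¬ G.Adj x y)
    (hQ : ClusterOn G Iᶜ n) : MonoOn G univ n :=
  ⟨I, subset_univ _, h, by rwa [← compl_eq_univ_sdiff]⟩

/-- If every vertex-deleted subgraph of a connected monopolar cograph is `(1, j)`-polar or a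
cluster, then the graph is `(1, j + 1)`-polar. -/
lemma IsCograph.monoOn_succ [Finite V] (hc : IsCograph G) (hG : G.Connected) (hj : 1 ≤ j)
    (hn : ∃ n, MonoOn G univ n)
    (hV : ∀ v, MonoOn G {v}ᶜ j ∨ ∃ n, ClusterOn G {v}ᶜ n) : MonoOn G univ (j + 1) := by
  classical
  by_contra hcon
  -- Here `n + 1` is the least number of colours that suffices. Then the cluster `Iᶜ` below has
  -- exactly `n + 1 > 2` components.
  obtain ⟨n, hn1, hn0, hjn⟩ : ∃ n, MonoOn G univ (n + 1) ∧ ¬ MonoOn G univ n ∧ j < n := by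
    have hs := Nat.find_spec hn
    have hmin := fun m => @Nat.find_min _ _ hn m
    set N := Nat.find hn
    have : j + 1 < N := by
      by_contra h
      exact hcon (hs.mono subset_rfl (by omega))
    refine ⟨N - 1, ?_, hmin _ (by omega), by omega⟩
    rwa [Nat.sub_add_cancel (by omega)]
  have h1 : ¬ MonoOn G univ 1 := fun h => hn0 (h.mono subset_rfl (by omega))
  obtain ⟨I, ⟨i, hi⟩, ⟨q, hq⟩, hI, hIQ, hQ⟩ := hc.exists_indep_join_cluster hG h1 hn1
  have hQn : ∀ m ≤ n, ¬ ClusterOn G Iᶜ m := fun m hm h =>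
    hn0 ((monoOn_of_indep_cluster hI h).mono subset_rfl hm)
  have hsplit : ∀ v ∈ Iᶜ, ({v}ᶜ : Set V) = I ∪ (Iᶜ \ {v}) := by
    intro v hv
    ext x
    simp only [mem_compl_iff, mem_singleton_iff, mem_union, mem_sdiff]
    by_cases hx : x ∈ I
    · simp only [hx, true_or, iff_true]
      rintro rfl
      exact hv hx
    · simp [hx]
  -- The path `x i y` survives the deletion of `v`, so `G - v` is `(1, j)`-polar. It cannot have `I`
  -- independent and `Iᶜ \ {v}` a cluster with `j` colours, since restoring `v` would use at most `j
  -- + 1 ≤ n`.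
  have hcases : ∀ v ∈ Iᶜ, ∀ x ∈ Iᶜ, ∀ y ∈ Iᶜ, x ≠ v → y ≠ v → x ≠ y → ¬ G.Adj x y →
      MonoOn G {v}ᶜ 1 ∨ ∀ x ∈ Iᶜ \ {v}, ∀ y ∈ Iᶜ \ {v}, ¬ G.Adj x y ∧ ClusterOn G I j := by
    intro v hv x hx y hy hxv hyv hxy hadj
    have hiv : i ≠ v := by rintro rfl; exact hv hi
    have hmono := (hV v).resolve_right fun ⟨n, h⟩ =>
      not_clusterOn_of_path hxv hiv hyv (hIQ i hi x hx).symm (hIQ i hi y hy) hxy hadj n h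
    rw [hsplit v hv] at hmono
    rcases hmono.join_cases ⟨i, hi⟩ ⟨x, hx, hxv⟩ (fun a ha b hb => hIQ a ha b hb.1)
      with h | ⟨-, h⟩ | ⟨h, h'⟩
    · rw [hsplit v hv]
      exact Or.inl h
    · exact absurd (hQ.add_vertex h) (hQn _ (by omega))
    · exact Or.inr fun x hx y hy => ⟨h x hx y hy, h'⟩
  -- If `Iᶜ` has an isolated vertex `v`, then `v` can join the independent part of `G - v`, which
  -- lies in `Iᶜ` in either case. Otherwise two components other than that of `q` give a `2K₂`
  -- avoiding `q`.
  by_cases hs : ∃ v ∈ Iᶜ, ∀ u ∈ Iᶜ, ¬ G.Adj v u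
  · obtain ⟨v, hv, hvu⟩ := hs
    obtain ⟨x, hx, y, hy, hxv, hyv, hxy, hadj⟩ : ∃ x ∈ Iᶜ, ∃ y ∈ Iᶜ, x ≠ v ∧ y ≠ v ∧ x ≠ y ∧
        ¬ G.Adj x y := by
      by_contra! h
      refine hQn 2 (by omega) (hQ.add_vertex (u := v) (n := 1) ⟨fun _ => 0, by simp, ?_⟩)
      intro a ha b hb hab
      simp [h a ha.1 b hb.1 ha.2 hb.2 hab]
    rcases hcases v hv x hx y hy hxv hyv hxy hadj with h | h
    · obtain ⟨A, hA, a1, a2⟩ := monoOn_one_iff.1 h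
      have hAI : ∀ a ∈ A, a ∈ Iᶜ := by
        intro a ha haI
        refine hadj (a2 x hxv (fun hxA => a1 a ha x hxA (hIQ a haI x hx)) y hyv
          (fun hyA => a1 a ha y hyA (hIQ a haI y hy)) hxy)
      refine h1 (monoOn_one_iff.2 ⟨insert v A, subset_univ _, ?_, fun a _ ha b _ hb hab => ?_⟩)
      · rintro a (rfl | ha) b (rfl | hb)
        · exact G.loopless.irrefl _
        · exact hvu b (hAI b hb)
        · exact fun h => hvu a (hAI a ha) h.symm
        · exact a1 a ha b hb
      · exact a2 a (fun h => ha (Or.inl h)) (fun h => ha (Or.inr h)) b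
          (fun h => hb (Or.inl h)) (fun h => hb (Or.inr h)) hab
    · refine hn0 (MonoOn.mono (m := j) ?_ subset_rfl hjn.le)
      refine monoOn_of_indep_cluster (I := Iᶜ) (fun a ha b hb hab => ?_) ?_
      · by_cases hav : a = v
        · subst hav; exact hvu b hb hab
        by_cases hbv : b = v
        · subst hbv; exact hvu a ha hab.symm
        exact (h a ⟨ha, hav⟩ b ⟨hb, hbv⟩).1 hab
      · rw [compl_compl]
        exact (h x ⟨hx, hxv⟩ x ⟨hx, hxv⟩).2
  · push Not at hs
    obtain ⟨f, -, f2⟩ := id hQ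
    obtain ⟨x, hx, y, hy, hxq, hyq, hxy⟩ : ∃ x ∈ Iᶜ, ∃ y ∈ Iᶜ, f x ≠ f q ∧ f y ≠ f q ∧
        f x ≠ f y := by
      by_contra! h
      refine hQn 2 (by omega) ⟨fun u => if f u = f q then 0 else 1, fun u _ => ?_, ?_⟩
      · dsimp only; split_ifs <;> omega
      · intro a ha b hb hab
        rw [f2 a ha b hb hab]
        have := h a ha b hb
        grind
    obtain ⟨x', hx', hxx'⟩ := hs x hx
    obtain ⟨y', hy', hyy'⟩ := hs y hy
    have ex := (f2 x hx x' hx' hxx'.ne).1 hxx'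
    have ey := (f2 y hy y' hy' hyy'.ne).1 hyy'
    have nadj : ∀ a ∈ Iᶜ, ∀ b ∈ Iᶜ, f a ≠ f b → ¬ G.Adj a b := fun a ha b hb hab h =>
      hab ((f2 a ha b hb h.ne).1 h)
    have ne : ∀ {a b : V}, f a ≠ f b → a ≠ b := fun h h' => h (by rw [h'])
    have hxy' := nadj x hx y hy hxy
    rcases hcases q hq x hx y hy (ne hxq) (ne hyq) (ne hxy) hxy' with h | h
    · refine HasTwoEdges.not_monoOn ⟨x, ne hxq, x', ne (by rwa [← ex]), y, ne hyq, y',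
        ne (by rwa [← ey]), hxx', hyy', hxy', ?_, ?_, ?_⟩ h
      · exact nadj x hx y' hy' (by rwa [← ey])
      · exact nadj x' hx' y hy (by rwa [← ex])
      · exact nadj x' hx' y' hy' (by rwa [← ey, ← ex])
    · exact (h x ⟨hx, ne hxq⟩ x' ⟨hx', ne (by rwa [← ex])⟩).1 hxx'

end Connected

/-! ### The graph `K₁ ⊕ 2K₂` -/

/-- The join of `K₁` and `2K₂` on the vertices `0, …, 4`. -/
abbrev butterfly : SimpleGraph (Fin 5) :=
  ofEdges 5 [(0, 1), (0, 2), (0, 3), (0, 4), (1, 2), (3, 4)]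

section Iso

variable {V : Type*} {G : SimpleGraph V} {n : ℕ}

lemma nonempty_iso_of_fin {F : SimpleGraph (Fin n)} (f : Fin n → V)
    (hne : ∀ i j, i < j → f i ≠ f j) (h : ∀ i j, i < j → (G.Adj (f i) (f j) ↔ F.Adj i j))
    (hs : Function.Surjective f) : Nonempty (F ≃g G) := by
  have hinj : Function.Injective f := fun i j hij => by
    rcases lt_trichotomy i j with h' | h' | h'
    · exact absurd hij (hne i j h')
    · exact h'
    · exact absurd hij.symm (hne j i h')
  refine ⟨⟨Equiv.ofBijective f ⟨hinj, hs⟩, fun {i j} => ?_⟩⟩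
  change G.Adj (f i) (f j) ↔ _
  rcases lt_trichotomy i j with h' | rfl | h'
  · exact h i j h'
  · simp
  · rw [G.adj_comm, F.adj_comm]
    exact h j i h'

lemma nonempty_butterfly_iso :
    Nonempty (butterfly ≃g join (K 1) (copies 2 (K 2))) := by
  refine nonempty_iso_of_fin ![Sum.inl 0, Sum.inr (0, 0), Sum.inr (0, 1), Sum.inr (1, 0),
    Sum.inr (1, 1)] (by decide) (fun i j hij => ?_) (by decide)
  fin_cases i <;> fin_cases j <;> simp [join, copies, ofEdges] at hij ⊢

lemma isCograph_butterfly : IsCograph butterfly := by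
  rw [isCograph_iff]
  decide

lemma clusterOn_butterfly_compl_center : ClusterOn butterfly {0}ᶜ 2 := by
  refine ⟨fun u => if 3 ≤ u then 1 else 0, fun u _ => ?_, ?_⟩
  · dsimp only; split_ifs <;> omega
  · simp only [mem_compl_iff, mem_singleton_iff]
    decide

lemma monoOn_butterfly : MonoOn butterfly univ 2 := by
  refine ⟨{0}, subset_univ _, by simp, ?_⟩
  rw [← compl_eq_univ_sdiff]
  exact clusterOn_butterfly_compl_center

lemma not_monoOn_butterfly : ¬ MonoOn butterfly univ 1 :=
  HasTwoEdges.not_monoOn ⟨1, trivial, 2, trivial, 3, trivial, 4, trivial, by decide⟩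

lemma not_clusterOn_butterfly : ¬ ClusterOn butterfly univ n :=
  HasPath.not_clusterOn ⟨1, trivial, 0, trivial, 3, trivial, by decide⟩

lemma polarOn_butterfly : PolarOn butterfly univ 1 := by
  refine polarOn_one_of_finset {0, 1, 2} ?_ ?_ <;> decide

lemma compl_butterfly (v : Fin 5) :
    MonoOn butterfly {v}ᶜ 1 ∨ ClusterOn butterfly {v}ᶜ (1 + 1) := by
  by_cases hv : v = 0
  · subst hv
    exact Or.inr clusterOn_butterfly_compl_center
  left
  rw [monoOn_one_iff]
  refine ⟨((![∅, {2, 3}, {1, 3}, {1, 4}, {1, 3}] : Fin 5 → Finset (Fin 5)) v : Set (Fin 5)), ?_⟩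
  simp only [subset_def, Finset.mem_coe, mem_compl_iff, mem_singleton_iff]
  revert v
  decide

end Iso

/-! ### Disjoint unions of edges -/

section Copies

variable {a n i : ℕ}

lemma clusterOn_copies : ClusterOn (copies a (K 2)) univ a := by
  refine ⟨fun p => p.1, fun p _ => p.1.2, ?_⟩
  rintro ⟨p, x⟩ - ⟨q, y⟩ - h
  simp only [copies, SimpleGraph.top_adj, Fin.val_inj, ne_eq,
    Prod.mk.injEq, not_and] at h ⊢
  exact ⟨fun h => h.1, fun h' => ⟨h', h h'⟩⟩

/-- An independent set misses an end of every edge, and these ends need distinct colours. -/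
lemma monoOn_copies_iff : MonoOn (copies a (K 2)) univ n ↔ a ≤ n := by
  constructor
  · rintro ⟨A, -, h1, f, h2, h3⟩
    have key : ∀ q : Fin a, ∃ e, (q, e) ∉ A := by
      intro q
      by_contra! h
      exact h1 _ (h 0) _ (h 1) ⟨rfl, by simp⟩
    choose e he using key
    have hf : ∀ q, f (q, e q) < n := fun q => h2 _ ⟨trivial, he q⟩
    let g : Fin a → Fin n := fun q => ⟨f (q, e q), hf q⟩
    have hg : Function.Injective g := by
      intro p q hpq
      by_contra hne
      have := (h3 (p, e p) ⟨trivial, he p⟩ (q, e q) ⟨trivial, he q⟩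
        (by simp [hne])).2 (Fin.mk.inj hpq)
      exact hne this.1
    simpa using Fintype.card_le_of_injective g hg
  · exact fun h => clusterOn_copies.monoOn.mono subset_rfl h

lemma le_of_monoOn_copies_compl {w : Fin a × Fin 2} (h : MonoOn (copies a (K 2)) {w}ᶜ n) :
    a ≤ n + 1 := by
  rw [compl_eq_univ_sdiff] at h
  exact monoOn_copies_iff.1 (MonoOn.add_vertex clusterOn_copies h)

lemma monoOn_copies_compl (w : Fin a × Fin 2) : MonoOn (copies a (K 2)) {w}ᶜ (a - 1) := by
  classical
  -- The independent set takes the partner of `w` and one end of every other edge, which saves the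
  -- colour of the damaged copy.
  refine ⟨{p | p ≠ w ∧ (p.2 = 0 ∨ p.1 = w.1)}, fun p hp => hp.1, ?_, ?_⟩
  · rintro ⟨p, x⟩ ⟨hp, hp'⟩ ⟨q, y⟩ ⟨hq, hq'⟩ ⟨h1, h2⟩
    obtain ⟨w, z⟩ := w
    dsimp only at h1 h2 hp' hq'
    subst h1
    have hxy : x ≠ y := h2
    by_cases hpw : p = w
    · subst hpw
      have hx : x ≠ z := fun h => hp (by rw [h])
      have hy : y ≠ z := fun h => hq (by rw [h])
      omega
    · have := hp'.resolve_right hpw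
      have := hq'.resolve_right hpw
      omega
  · refine ClusterOn.of_finset (fun p => p.1) (Finset.univ.erase w.1) ?_ (by simp) ?_
    · rintro p ⟨hp, hp'⟩
      simp only [mem_ofPred_eq, not_and, not_or] at hp'
      simpa using (hp' hp).2
    · rintro ⟨p, x⟩ ⟨hp, hp'⟩ ⟨q, y⟩ ⟨hq, hq'⟩ h
      simp only [copies, SimpleGraph.top_adj, ne_eq,
        Prod.mk.injEq, not_and] at h ⊢
      exact ⟨fun h => h.1, fun h' => ⟨h', h h'⟩⟩

lemma isCograph_of_clusterOn {V : Type*} {G : SimpleGraph V} (h : ClusterOn G univ n) :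
    IsCograph G := by
  rw [isCograph_iff]
  intro p q r s hpq hqr hrs hpr hps hqs
  refine hpr (h.adj_trans trivial trivial trivial hpq hqr ?_)
  rintro rfl
  exact hps hrs

/-- A graph in which every vertex has exactly one neighbour is a disjoint union of edges. -/
lemma exists_iso_copies {V : Type*} [Finite V] {G : SimpleGraph V} (h : ∀ u, ∃! w, G.Adj u w) :
    ∃ a, Nonempty (G ≃g copies a (K 2)) := by
  classical
  -- The unique neighbour defines a fixed-point-free involution, whose orbits are the edges.
  choose t ht hu using h
  dsimp only at hu
  have htt : ∀ u, t (t u) = u := fun u => (hu (t u) u (ht u).symm).symm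
  have htne : ∀ u, t u ≠ u := fun u => (ht u).ne'
  have adj_iff : ∀ u w, G.Adj u w ↔ w = t u := fun u w => ⟨hu u w, fun h => h ▸ ht u⟩
  let r : Setoid V :=
    { r := fun x y => x = y ∨ x = t y
      iseqv := by
        refine ⟨fun x => Or.inl rfl, ?_, ?_⟩
        · rintro x y (rfl | rfl)
          · exact Or.inl rfl
          · exact Or.inr (htt y).symm
        · rintro x y z (rfl | rfl) (rfl | rfl)
          · exact Or.inl rfl
          · exact Or.inr rfl
          · exact Or.inr rfl
          · exact Or.inl (htt z) }
  have := Fintype.ofFinite V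
  have := Fintype.ofFinite (Quotient r)
  let f : V → Quotient r := Quotient.mk r
  have hf : ∀ x y, f x = f y ↔ x = y ∨ x = t y := fun x y => Quotient.eq
  have hcard : ∀ q, Fintype.card {v // f v = q} = 2 := by
    intro q
    induction q using Quotient.inductionOn with
    | _ x =>
      rw [Fintype.card_subtype, show Finset.univ.filter (fun v => f v = Quotient.mk r x) = {x, t x}
        from ?_, Finset.card_pair (htne x).symm]
      ext v
      simpa using hf v x
  let e : V ≃ Fin (Fintype.card (Quotient r)) × Fin 2 :=
    ((Equiv.sigmaFiberEquiv f).symm.trans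
      ((Equiv.sigmaCongrRight fun q => Fintype.equivFinOfCardEq (hcard q)).trans
        (Equiv.sigmaEquivProd _ _))).trans
      ((Fintype.equivFin (Quotient r)).prodCongr (Equiv.refl _))
  have he : ∀ x, (e x).1 = Fintype.equivFin (Quotient r) (f x) := fun x => rfl
  refine ⟨Fintype.card (Quotient r), ⟨⟨e, fun {x y} => ?_⟩⟩⟩
  change (e x).1 = (e y).1 ∧ (e x).2 ≠ (e y).2 ↔ _
  have h1 : (e x).1 = (e y).1 ↔ x = y ∨ x = t y := by
    rw [he, he, Equiv.apply_eq_iff_eq, hf]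
  have h2 : (e x).1 = (e y).1 → ((e x).2 = (e y).2 ↔ x = y) := fun h => by
    rw [← e.apply_eq_iff_eq (x := x), Prod.ext_iff, and_iff_right h]
  rw [G.adj_comm, adj_iff]
  constructor
  · rintro ⟨h, h'⟩
    exact (h1.1 h).resolve_left fun hxy => h' ((h2 h).2 hxy)
  · intro h
    have h3 := h1.2 (Or.inr h)
    exact ⟨h3, fun h4 => htne y (((h2 h3).1 h4).symm.trans h).symm⟩

end Copies

/-! ### The listed graphs are residues -/

section Backward

variable {V : Type*} {D : SimpleGraph V} {a j m : ℕ}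

/-- The common form of conditions 1 to 3: the edges cost `a` colours and `D` costs `j + 1`, one more
in total than the `m + 1` available. The path is the case `j = 0`. -/
lemma isResidue_copies_sum (hm : a + j = m + 1) (hc : IsCograph D) (h1 : MonoOn D univ (j + 1))
    (h0 : ¬ MonoOn D univ j) (hp : ∀ n, ¬ ClusterOn D univ n) (hE : PolarOn D univ j)
    (hV : ∀ v, MonoOn D {v}ᶜ j ∨ ClusterOn D {v}ᶜ (j + 1)) :
    IsResidue m (copies a (K 2) ⊕g D) := by
  refine ⟨isCograph_sum.2 ⟨isCograph_of_clusterOn clusterOn_copies, hc⟩, fun h => ?_, fun h => ?_,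
    ?_, Or.inl ?_, ?_⟩
  · obtain ⟨i, l, hil, hi, hl⟩ := monoOn_sum.1 h
    have := monoOn_copies_iff.1 hi
    exact h0 (hl.mono subset_rfl (by omega))
  · obtain ⟨i, l, hil, hi, hl⟩ := clusterOn_sum.1 h
    exact hp _ hl
  · exact polarOn_sum_of_right hm.le clusterOn_copies hE
  · exact monoOn_sum.2 ⟨a, j + 1, by omega, monoOn_copies_iff.2 le_rfl, h1⟩
  · rintro (w | v)
    · have ha : 1 ≤ a := by
        have := w.1.2
        omega
      refine Or.inl (monoOn_sum.2 ⟨a - 1, j + 1, by omega, ?_, ?_⟩)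
      · rw [preimage_inl_compl_inl]; exact monoOn_copies_compl w
      · rw [preimage_inr_compl_inl]; exact h1
    · rcases hV v with h | h
      · refine Or.inl (monoOn_sum.2 ⟨a, j, by omega, ?_, ?_⟩)
        · rw [preimage_inl_compl_inr]; exact monoOn_copies_iff.2 le_rfl
        · rw [preimage_inr_compl_inr]; exact h
      · refine Or.inr (clusterOn_sum.2 ⟨a, j + 1, by omega, ?_, ?_⟩)
        · rw [preimage_inl_compl_inr]; exact clusterOn_copies
        · rw [preimage_inr_compl_inr]; exact h

lemma isResidue_copies_sum_P3 : IsResidue m (copies (m + 1) (K 2) ⊕g P3) := by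
  refine isResidue_copies_sum (j := 0) rfl isCograph_P3 monoOn_P3
    (fun h => by simpa using one_le_of_monoOn_P3 h) (fun n => not_clusterOn_P3) polarOn_P3 ?_
  intro v
  by_cases hv : v = 1
  · subst hv
    exact Or.inl monoOn_P3_compl_center
  · exact Or.inr (clusterOn_P3_compl_end hv)

lemma isResidue_copies_sum_butterfly :
    IsResidue m (copies m (K 2) ⊕g join (K 1) (copies 2 (K 2))) := by
  obtain ⟨e⟩ := nonempty_butterfly_iso
  exact (isResidue_copies_sum (j := 1) rfl isCograph_butterfly monoOn_butterfly
    not_monoOn_butterfly (fun n => not_clusterOn_butterfly) polarOn_butterfly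
    compl_butterfly).of_iso (SimpleGraph.Iso.sumCongr SimpleGraph.Iso.refl e.symm)

lemma isResidue_copies_sum_obstruction [Finite V] (hm : a + j = m + 1) (hj : 1 ≤ j)
    (hD : D.Connected) (h : IsCographMinimalObstruction 1 (j : ℕ∞) D)
    (h' : ¬ IsCographMinimalObstruction 1 ⊤ D) : IsResidue m (copies a (K 2) ⊕g D) := by
  obtain ⟨hc, h0, hV⟩ := isCographMinimalObstruction_one_coe_iff.1 h
  have hn : ∃ n, MonoOn D univ n := by
    by_contra hn
    exact h' (isCographMinimalObstruction_one_top_iff.2 ⟨hc, hn, fun v => ⟨j, hV v⟩⟩)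
  have h1 := hc.monoOn_succ hD hj hn fun v => Or.inl (hV v)
  obtain ⟨I, hI, hQ, hind, hIQ, hcl⟩ := hc.exists_indep_join_cluster hD
    (fun h => h0 (h.mono subset_rfl hj)) h1
  refine isResidue_copies_sum hm hc h1 h0 (fun n hn => ?_) ?_ fun v => Or.inl (hV v)
  · rw [← union_compl_self I] at hn h0
    exact h0 ((hn.monoOn_one_of_join hI hQ hIQ).mono subset_rfl hj)
  · obtain ⟨f, f1, f2⟩ := hcl
    have key : ∀ x, x ∉ I → ∀ y, y ∉ I → f x = j → f y = j → ¬ D.Adj x y → x = y := by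
      intro x hx y hy hfx hfy hxy
      by_contra hne
      exact hxy ((f2 x hx y hy hne).2 (hfx.trans hfy.symm))
    -- Moving the last clique of the cluster next to `I` gives a complete multipartite graph, with
    -- `I` as one part and singletons as the others; `j` colours remain.
    refine ⟨{x | x ∈ I ∨ f x = j}, subset_univ _, ?_, f, ?_, ?_⟩
    · intro x hx y hy z hz hxy hyz
      by_cases hyI : y ∈ I
      · have hxI : x ∈ I := by
          by_contra hxI
          exact hxy (hIQ y hyI x hxI).symm
        have hzI : z ∈ I := by
          by_contra hzI
          exact hyz (hIQ y hyI z hzI)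
        exact hind x hxI z hzI
      · have hxI : x ∉ I := fun hxI => hxy (hIQ x hxI y hyI)
        have hzI : z ∉ I := fun hzI => hyz (hIQ z hzI y hyI).symm
        have e1 := key x hxI y hyI (hx.resolve_left hxI) (hy.resolve_left hyI) hxy
        subst e1
        exact hyz
    · rintro u ⟨-, hu⟩
      simp only [mem_ofPred_eq, not_or] at hu
      have := f1 u hu.1
      omega
    · rintro u ⟨-, hu⟩ v ⟨-, hv⟩
      simp only [mem_ofPred_eq, not_or] at hu hv
      exact f2 u hu.1 v hv.1

end Backward

/-! ### The structure of monopolar residues -/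

section Forward

variable {V W : Type*} {G : SimpleGraph V} {D : SimpleGraph V} {H : SimpleGraph W} {a j m n : ℕ}

/-- In a cluster, the first part of an `(∞, m+1)`-polar partition contains an edge, so it lies in
one component. Giving that whole component a new colour would produce a cluster with `m + 2`
colours. -/
lemma IsResidue.not_clusterOn_univ (h : IsResidue m H) : ¬ ClusterOn H univ n := by
  classical
  rintro hcl
  obtain ⟨A, hA, h1, g, g1, g2⟩ := h.polarOn
  have hA' : ∃ a ∈ A, ∃ b ∈ A, H.Adj a b := by
    by_contra! hind
    exact h.not_monoOn ⟨A, hA, hind, g, g1, g2⟩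
  obtain ⟨a, ha, b, hb, hab⟩ := hA'
  have near : ∀ x ∈ A, x = a ∨ H.Adj x a := by
    intro x hx
    by_contra! hxa
    by_cases hxb : H.Adj x b
    · exact hxa.2 (hcl.adj_trans trivial trivial trivial hxb hab.symm hxa.1)
    · exact h1 a ha x hx b hb (fun h => hxa.2 h.symm) hxb hab
  have tr : ∀ x y, x ≠ y → (x = a ∨ H.Adj x a) → H.Adj x y → (y = a ∨ H.Adj y a) := by
    rintro x y hxy (rfl | hx) hadj
    · exact Or.inr hadj.symm
    · by_cases hya : y = a
      · exact Or.inl hya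
      · exact Or.inr (hcl.adj_trans trivial trivial trivial hadj.symm hx hya)
  refine h.not_clusterOn ⟨fun x => if x = a ∨ H.Adj x a then m + 1 else g x, fun x _ => ?_,
    fun x _ y _ hxy => ?_⟩
  · dsimp only
    split_ifs with hx
    · omega
    · have := g1 x ⟨trivial, fun hxA => hx (near x hxA)⟩
      omega
  · dsimp only
    split_ifs with hx hy hy
    · simp only [iff_true]
      rcases hx with rfl | hx <;> rcases hy with rfl | hy
      · exact absurd rfl hxy
      · exact hy.symm
      · exact hx
      · exact hcl.adj_trans trivial trivial trivial hx hy.symm hxy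
    · have := g1 y ⟨trivial, fun hyA => hy (near y hyA)⟩
      refine iff_of_false (fun h => hy (tr x y hxy hx h)) (by omega)
    · have := g1 x ⟨trivial, fun hxA => hx (near x hxA)⟩
      refine iff_of_false (fun h => hx (tr y x (Ne.symm hxy) hy h.symm)) (by omega)
    · exact g2 x ⟨trivial, fun hxA => hx (near x hxA)⟩ y ⟨trivial, fun hyA => hy (near y hyA)⟩ hxy

/-- In a residue with a component that is not a clique, the other components are edges. -/
lemma IsResidue.exists_iso_copies [Finite W] (h : IsResidue m (H ⊕g D)) (hD : HasPath D univ) :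
    ∃ a, Nonempty (H ≃g copies a (K 2)) := by
  obtain ⟨c, hcl⟩ : ∃ c, ClusterOn H univ c := by
    rcases h.polarOn.sum_cases with h' | ⟨i, l, -, -, hl⟩ | ⟨i, l, -, hi, -⟩
    · exact absurd h' h.not_monoOn
    · exact absurd hl hD.not_clusterOn
    · exact ⟨i, hi⟩
  -- The induced path in `D` survives the deletion of `w`, so only the monopolar alternative
  -- remains.
  have hV : ∀ w, ∃ i l, i + l ≤ m + 1 ∧ MonoOn H (univ \ {w}) i ∧ MonoOn D univ l := by
    intro w
    rcases h.compl (Sum.inl w) with h' | h'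
    · obtain ⟨i, l, hil, hi, hl⟩ := monoOn_sum.1 h'
      rw [preimage_inl_compl_inl, compl_eq_univ_sdiff] at hi
      rw [preimage_inr_compl_inl] at hl
      exact ⟨i, l, hil, hi, hl⟩
    · obtain ⟨i, l, hil, hi, hl⟩ := clusterOn_sum.1 h'
      rw [preimage_inr_compl_inl] at hl
      exact absurd hl hD.not_clusterOn
  have hN : ∀ i l, i + l ≤ m + 1 → MonoOn H univ i → ¬ MonoOn D univ l :=
    fun i l hil hi hl => h.not_monoOn (monoOn_sum.2 ⟨i, l, hil, hi, hl⟩)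
  -- A vertex of `H` with no neighbour, or with two, could be restored without a new colour.
  refine Polarity.exists_iso_copies fun u => ?_
  obtain ⟨i, l, hil, hi, hl⟩ := hV u
  obtain ⟨x, hx⟩ : ∃ x, H.Adj u x := by
    by_contra! hu
    exact hN i l hil (hi.add_of_isolated (fun x _ => hu x) trivial) hl
  refine ⟨x, hx, fun y hy => ?_⟩
  by_contra hyx
  exact hN i l hil (MonoOn.add_of_adj hcl trivial trivial trivial hx.symm hy.symm (Ne.symm hyx) hi)
    hl

/-- A connected cograph with a vertex whose removal leaves a cluster of too many components. -/
lemma IsCograph.nonempty_butterfly_iso [Finite V] (hc : IsCograph D) (hD : D.Connected)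
    (hj : 1 ≤ j) (h0 : ¬ MonoOn D univ j) {v : V} (hv : ∃ n, ClusterOn D {v}ᶜ n)
    (hvj : ¬ MonoOn D {v}ᶜ j) (hV : ∀ u, MonoOn D {u}ᶜ j ∨ ∃ n, ClusterOn D {u}ᶜ n) :
    j = 1 ∧ Nonempty (butterfly ≃g D) := by
  obtain ⟨c, hcl⟩ := hv
  -- If `v` were not alone on its side of the join, the cluster `D - v` would be a join, hence a
  -- clique, hence `(1, j)`-polar.
  have hadj : ∀ u, u ≠ v → D.Adj v u := by
    have side : ∀ X : Set V, v ∈ X → Xᶜ.Nonempty → (∀ x ∈ X, ∀ y ∈ Xᶜ, D.Adj x y) →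
        ∀ u, u ≠ v → D.Adj v u := by
      intro X hvX hY hXY u hu
      by_cases hX : ∃ x ∈ X, x ≠ v
      · obtain ⟨x, hx, hxv⟩ := hX
        have e : ({v}ᶜ : Set V) = X \ {v} ∪ Xᶜ := by
          ext z
          simp only [mem_compl_iff, mem_singleton_iff, mem_union, mem_sdiff]
          by_cases hz : z ∈ X
          · simp [hz]
          · simp only [hz, false_and, not_false_eq_true, or_true, iff_true]
            rintro rfl
            exact hz hvX
        rw [e] at hcl hvj
        exact absurd ((hcl.monoOn_one_of_join ⟨x, hx, hxv⟩ hY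
          fun x hx y hy => hXY x hx.1 y hy).mono subset_rfl hj) hvj
      · push Not at hX
        exact hXY v hvX u fun huX => hu (hX u huX)
    obtain ⟨X, hX, hY, hXY⟩ := hc.exists_join hD (nontrivial_of_not_monoOn h0)
    by_cases hvX : v ∈ X
    · exact side X hvX hY hXY
    · exact side Xᶜ hvX (by rwa [compl_compl]) (by
        rw [compl_compl]; exact fun x hx y hy => (hXY y hy x hx).symm)
  obtain ⟨f, -, f2⟩ := id hcl
  have hvj1 : ¬ MonoOn D {v}ᶜ 1 := fun h => hvj (h.mono subset_rfl hj)
  -- The cluster `D - v` is not split, so two of its components contain edges.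
  obtain ⟨x, hx, x', hx', hxx'⟩ : ∃ x, x ≠ v ∧ ∃ x', x' ≠ v ∧ D.Adj x x' := by
    by_contra! h
    exact hvj1 ⟨{v}ᶜ, subset_rfl, h, by simpa using clusterOn_empty⟩
  obtain ⟨y, hy, hyx, y', hy', hyx', hyy'⟩ : ∃ y, y ≠ v ∧ f y ≠ f x ∧
      ∃ y', y' ≠ v ∧ f y' ≠ f x ∧ D.Adj y y' := by
    by_contra! h
    refine hvj1 (monoOn_one_iff.2 ⟨{u | u ≠ v ∧ f u ≠ f x}, fun u hu => hu.1,
      fun a ha b hb => h a ha.1 ha.2 b hb.1 hb.2, ?_⟩)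
    intro a ha haA b hb hbA hab
    simp only [mem_ofPred_eq, not_and, not_not] at haA hbA
    exact (f2 a ha b hb hab).2 ((haA ha).trans (hbA hb).symm)
  have ex := (f2 x hx x' hx' hxx'.ne).1 hxx'
  have nadj : ∀ a, a ≠ v → ∀ b, b ≠ v → f b ≠ f a → ¬ D.Adj a b := fun a ha b hb hab h =>
    hab ((f2 a ha b hb h.ne).1 h).symm
  have nxy := nadj x hx y hy hyx
  have nxy' := nadj x hx y' hy' hyx'
  have nx'y := nadj x' hx' y hy (by rwa [← ex])
  have nx'y' := nadj x' hx' y' hy' (by rwa [← ex])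
  have n1 : x ≠ y := by rintro rfl; exact hyx rfl
  have n2 : x ≠ y' := by rintro rfl; exact hyx' rfl
  have n3 : x' ≠ y := by rintro rfl; exact hyx ex.symm
  have n4 : x' ≠ y' := by rintro rfl; exact hyx' ex.symm
  have hpath : ∀ u, u ≠ v → u ≠ x → u ≠ y → MonoOn D {u}ᶜ j := fun u h1 h2 h3 =>
    (hV u).resolve_right fun ⟨n, h⟩ => not_clusterOn_of_path (a := x) (b := v) (c := y)
      (Ne.symm h2) (Ne.symm h1) (Ne.symm h3) (hadj x hx).symm (hadj y hy) n1 nxy n h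
  -- For `j ≥ 2`, delete `x'`. If the result is split, restoring `x'` to the cluster costs one
  -- colour, at most two in all. If `D - v - x'` has `j` cliques, `x'` returns to the clique of `x`
  -- for free. The edge `yy'` excludes the third case.
  have hj1 : j = 1 := by
    by_contra hj1
    have h := hpath x' hx' hxx'.ne' n3
    have e : ({x'}ᶜ : Set V) = {v} ∪ ({v}ᶜ \ {x'}) := by
      ext z
      simp only [mem_compl_iff, mem_singleton_iff, mem_union, mem_sdiff]
      by_cases hz : z = v
      · simp [hz, Ne.symm hx']
      · simp [hz]
    rw [e] at h
    rcases h.join_cases (singleton_nonempty v) ⟨x, hx, hxx'.ne⟩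
      (by rintro _ rfl u hu; exact hadj u hu.1) with h | ⟨-, h⟩ | ⟨h, -⟩
    · exact hvj ((MonoOn.add_vertex hcl (h.mono subset_union_right le_rfl)).mono subset_rfl
        (by omega))
    · exact hvj (hcl.add_of_adj h hx' hx hxx').monoOn
    · exact h y ⟨hy, n3.symm⟩ y' ⟨hy', n4.symm⟩ hyy'
  subst hj1
  refine ⟨rfl, nonempty_iso_of_fin ![v, x, x', y, y'] (fun i j hij => ?_) (fun i j hij => ?_)
    fun u => ?_⟩
  · fin_cases i <;> fin_cases j <;>
      simp [Ne.symm hx, Ne.symm hx', Ne.symm hy, Ne.symm hy', hxx'.ne, hyy'.ne,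
        n1, n2, n3, n4] at hij ⊢
  · fin_cases i <;> fin_cases j <;>
      simp [ofEdges, hadj, hx, hx', hy, hy', hxx', hyy', nxy, nxy', nx'y, nx'y'] at hij ⊢
  -- A sixth vertex could be deleted leaving the `2K₂` intact, although `D - u` has to be split.
  · by_contra! h
    have h0 : v ≠ u := h 0
    have h1 : x ≠ u := h 1
    have h2 : x' ≠ u := h 2
    have h3 : y ≠ u := h 3
    have h4 : y' ≠ u := h 4
    exact HasTwoEdges.not_monoOn ⟨x, h1, x', h2, y, h3, y', h4, hxx', hyy', nxy, nxy', nx'y, nx'y'⟩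
      (hpath u h0.symm h1.symm h3.symm)

/-- The possible connected parts of a monopolar residue. -/
lemma IsResidue.connected_cases [Finite V] (h : IsResidue m (copies a (K 2) ⊕g D))
    (hD : D.Connected) (hp : HasPath D univ) (hn : ∃ n, MonoOn D univ n) :
    (a = m + 1 ∧ Nonempty (P3 ≃g D)) ∨
    (a = m ∧ Nonempty (butterfly ≃g D)) ∨
    ∃ j, 1 ≤ j ∧ a + j = m + 1 ∧ IsCographMinimalObstruction 1 (j : ℕ∞) D ∧
      ¬ IsCographMinimalObstruction 1 ⊤ D := by
  classical
  have hc := (isCograph_sum.1 h.isCograph).2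
  have hV : ∀ v, (∃ l, a + l ≤ m + 1 ∧ MonoOn D {v}ᶜ l) ∨ ∃ n, ClusterOn D {v}ᶜ n := by
    intro v
    rcases h.compl (Sum.inr v) with h' | h'
    · obtain ⟨i, l, hil, hi, hl⟩ := monoOn_sum.1 h'
      rw [preimage_inl_compl_inr] at hi
      rw [preimage_inr_compl_inr] at hl
      have := monoOn_copies_iff.1 hi
      exact Or.inl ⟨l, by omega, hl⟩
    · obtain ⟨i, l, hil, hi, hl⟩ := clusterOn_sum.1 h'
      rw [preimage_inr_compl_inr] at hl
      exact Or.inr ⟨l, hl⟩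
  have hN : ∀ l, MonoOn D univ l → m + 2 ≤ a + l := by
    intro l hl
    by_contra hcon
    exact h.not_monoOn (monoOn_sum.2 ⟨a, l, by omega, monoOn_copies_iff.2 le_rfl, hl⟩)
  have ham : a ≤ m + 1 ∧ MonoOn D univ (m + 1 - a + 1) := by
    -- With no edges the bound comes from `IsCograph.monoOn_succ`. Otherwise deleting an end of one
    -- edge leaves `a - 1` edges to pay for.
    rcases Nat.eq_zero_or_pos a with rfl | ha
    · refine ⟨by omega, hc.monoOn_succ hD (by omega) hn fun v => ?_⟩
      rcases hV v with ⟨l, hl, h'⟩ | h'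
      · exact Or.inl (h'.mono subset_rfl (by omega))
      · exact Or.inr h'
    · rcases h.compl (Sum.inl (⟨0, ha⟩, 0)) with h' | h'
      · obtain ⟨i, l, hil, hi, hl⟩ := monoOn_sum.1 h'
        rw [preimage_inl_compl_inl] at hi
        rw [preimage_inr_compl_inl] at hl
        have := le_of_monoOn_copies_compl hi
        have hl1 : 1 ≤ l := by
          obtain ⟨p, -, q, -, -, -, hpq, -⟩ := hp
          exact hl.pos trivial trivial hpq
        exact ⟨by omega, hl.mono subset_rfl (by omega)⟩
      · obtain ⟨i, l, hil, hi, hl⟩ := clusterOn_sum.1 h'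
        rw [preimage_inr_compl_inl] at hl
        exact absurd hl hp.not_clusterOn
  obtain ⟨ham, h1⟩ := ham
  obtain ⟨j, hj⟩ : ∃ j, a + j = m + 1 := ⟨m + 1 - a, by omega⟩
  rw [show m + 1 - a = j by omega] at h1
  have h0 : ¬ MonoOn D univ j := fun h => by
    have := hN j h
    omega
  have hV' : ∀ v, MonoOn D {v}ᶜ j ∨ ∃ n, ClusterOn D {v}ᶜ n := fun v => by
    rcases hV v with ⟨l, hl, h'⟩ | h'
    · exact Or.inl (h'.mono subset_rfl (by omega))
    · exact Or.inr h'
  -- For `j = 0` each `D - u` is edgeless or a cluster, so `D` has no vertex outside the induced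
  -- path.
  rcases Nat.eq_zero_or_pos j with rfl | hj1
  · left
    refine ⟨hj, ?_⟩
    obtain ⟨p, -, q, -, r, -, hpq, hqr, hne, hpr⟩ := hp
    refine nonempty_iso_of_fin ![p, q, r] (fun i j hij => ?_) (fun i j hij => ?_) fun u => ?_
    · fin_cases i <;> fin_cases j <;> simp [hpq.ne, hqr.ne, hne] at hij ⊢
    · fin_cases i <;> fin_cases j <;> simp [P3_adj_iff, hpq, hqr, hpr] at hij ⊢
    · by_contra! h
      have e1 : p ≠ u := h 0
      have e2 : q ≠ u := h 1
      have e3 : r ≠ u := h 2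
      rcases hV' u with h' | ⟨n, h'⟩
      · exact absurd (h'.pos (a := p) (b := q) e1 e2 hpq) (by omega)
      · exact not_clusterOn_of_path (a := p) (b := q) (c := r) e1 e2 e3 hpq hqr hne hpr n h'
  · right
    by_cases hall : ∀ v, MonoOn D {v}ᶜ j
    · right
      refine ⟨j, hj1, hj, isCographMinimalObstruction_one_coe_iff.2 ⟨hc, h0, hall⟩, fun h' => ?_⟩
      exact (isCographMinimalObstruction_one_top_iff.1 h').2.1 hn
    · left
      push Not at hall
      obtain ⟨v, hv⟩ := hall
      obtain ⟨rfl, he⟩ := hc.nonempty_butterfly_iso hD hj1 h0 ((hV' v).resolve_left hv) hv hV'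
      exact ⟨by omega, he⟩

/-- A monopolar residue is a disjoint union of edges and a connected graph. -/
lemma IsResidue.exists_iso_sum {V : Type u} [Finite V] {H : SimpleGraph V} (h : IsResidue m H)
    (hn : ∃ n, MonoOn H univ n) :
    ∃ (a : ℕ) (U : Type u) (_ : Finite U) (D : SimpleGraph U), D.Connected ∧ HasPath D univ ∧
      (∃ n, MonoOn D univ n) ∧ Nonempty (H ≃g copies a (K 2) ⊕g D) := by
  obtain ⟨p, -, q, -, r, -, hpq, hqr, hne, hpr⟩ := hasPath_of_not_clusterOn
    (S := univ) fun ⟨n, hn⟩ => h.not_clusterOn_univ (n := n) hn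
  let C := H.connectedComponentMk p
  have hq : q ∈ C := SimpleGraph.ConnectedComponent.sound hpq.symm.reachable
  have hr : r ∈ C := SimpleGraph.ConnectedComponent.sound
    (hqr.symm.reachable.trans hpq.symm.reachable)
  have hp : p ∈ C := rfl
  have hpath : HasPath C.toSimpleGraph univ :=
    ⟨⟨p, hp⟩, trivial, ⟨q, hq⟩, trivial, ⟨r, hr⟩, trivial, hpq, hqr,
      fun h => hne (congrArg Subtype.val h), hpr⟩
  obtain ⟨e⟩ := nonempty_sum_component_iso C
  have h' := h.of_iso e.symm
  obtain ⟨a, ⟨e'⟩⟩ := h'.exists_iso_copies hpath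
  refine ⟨a, C, inferInstance, C.toSimpleGraph, C.connected_toSimpleGraph, hpath, ?_,
    ⟨e.trans (SimpleGraph.Iso.sumCongr e' SimpleGraph.Iso.refl)⟩⟩
  obtain ⟨n, hn⟩ := hn
  obtain ⟨i, l, -, -, hl⟩ := monoOn_sum.1 ((monoOn_univ_iso e).2 hn)
  exact ⟨l, hl⟩

end Forward

end Polarity

/-! ### Assembly of the equivalence -/

theorem mainTheorem5 (k : ℕ) (hk : 2 ≤ k) {V : Type u} [Finite V] (G : SimpleGraph V)
    (hG : ∃ C : G.ConnectedComponent, Nonempty (C.toSimpleGraph ≃g Polarity.P3)) :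
    Polarity.IsCographMinimalObstruction ⊤ (k : ℕ∞) G ↔
      ∃ (W : Type u) (_ : Finite W) (H : SimpleGraph W),
        Nonempty (G ≃g Polarity.P3 ⊕g H) ∧
        (Nonempty (H ≃g Polarity.P3 ⊕g Polarity.copies (k - 1) (Polarity.K 2)) ∨
         Nonempty (H ≃g Polarity.copies (k - 2) (Polarity.K 2) ⊕g
            Polarity.join (Polarity.K 1) (Polarity.copies 2 (Polarity.K 2))) ∨
         (∃ j : ℕ, 1 ≤ j ∧ j ≤ k - 1 ∧
            ∃ (U : Type u) (_ : Finite U) (Hj : SimpleGraph U),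
              Hj.Connected ∧
              Polarity.IsCographMinimalObstruction 1 (j : ℕ∞) Hj ∧
              ¬ Polarity.IsCographMinimalObstruction 1 ⊤ Hj ∧
              Nonempty (H ≃g Polarity.copies (k - j - 1) (Polarity.K 2) ⊕g Hj)) ∨
         (3 ≤ k ∧ Polarity.IsCographMinimalObstruction 1 ⊤ H)) := by
  open Polarity in
  obtain ⟨m, rfl⟩ : ∃ m, k = m + 2 := ⟨k - 2, by omega⟩
  constructor
  · intro h
    obtain ⟨C, ⟨eC⟩⟩ := hG
    obtain ⟨e⟩ := nonempty_sum_component_iso C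
    have e' : G ≃g P3 ⊕g G.induce C.suppᶜ :=
      (e.trans SimpleGraph.Iso.sumComm).trans (SimpleGraph.Iso.sumCongr eC SimpleGraph.Iso.refl)
    refine ⟨_, inferInstance, G.induce C.suppᶜ, ⟨e'⟩, ?_⟩
    have hres := isCographMinimalObstruction_P3_sum.1
      (IsCographMinimalObstruction.of_iso e'.symm h)
    -- The non-monopolar case gives condition 4 and the monopolar case gives the other three.
    by_cases hn : ∃ n, MonoOn (G.induce C.suppᶜ) Set.univ n
    swap
    · obtain ⟨h1, h2⟩ := (isResidue_iff_of_not_monoOn hn).1 hres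
      exact Or.inr (Or.inr (Or.inr ⟨by omega, h2⟩))
    obtain ⟨a, U, hU, D, hD, hp, hn, ⟨eD⟩⟩ := hres.exists_iso_sum hn
    rcases (hres.of_iso eD.symm).connected_cases hD hp hn with
      ⟨rfl, ⟨f⟩⟩ | ⟨rfl, ⟨f⟩⟩ | ⟨j, hj1, hj, h1, h2⟩
    · exact Or.inl ⟨(eD.trans SimpleGraph.Iso.sumComm).trans
        (SimpleGraph.Iso.sumCongr f.symm SimpleGraph.Iso.refl)⟩
    · obtain ⟨b⟩ := nonempty_butterfly_iso
      exact Or.inr (Or.inl ⟨eD.trans (SimpleGraph.Iso.sumCongr SimpleGraph.Iso.refl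
        (f.symm.trans b))⟩)
    · obtain rfl : a = m + 2 - j - 1 := by omega
      exact Or.inr (Or.inr (Or.inl ⟨j, hj1, by omega, U, hU, D, hD, h1, h2, ⟨eD⟩⟩))
  · rintro ⟨W, _, H, ⟨e⟩, hH⟩
    refine IsCographMinimalObstruction.of_iso e (isCographMinimalObstruction_P3_sum.2 ?_)
    rcases hH with ⟨⟨f⟩⟩ | ⟨⟨f⟩⟩ | ⟨j, hj1, hj, U, _, D, hD, h1, h2, ⟨f⟩⟩ | ⟨h3, h⟩
    · exact isResidue_copies_sum_P3.of_iso (f.trans SimpleGraph.Iso.sumComm)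
    · exact isResidue_copies_sum_butterfly.of_iso f
    · exact (isResidue_copies_sum_obstruction (by omega) hj1 hD h1 h2).of_iso f
    · exact (isResidue_iff_of_not_monoOn (isCographMinimalObstruction_one_top_iff.1 h).2.1).2
        ⟨by omega, h⟩
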